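/- A parameterized problem is a set $L\subseteq\Sigma^*\times\mathbb N$ with $\Sigma$ a finite alphabet; in a pair $(u,k)$ the number $k$ is the parameter. An fpt-reduction from $K\subseteq\Sigma_1^*\times\mathbb N$ to $L\subseteq\Sigma_2^*\times\mathbb N$ is a map $r(u,k)=(g(u,k),h(k))$, where the new parameter $h(k)$ depends on $k$ only, that can be computed in time $\mathrm{poly}(|u|)\cdot f(k)$ for some computable $f:\mathbb N\to\mathbb N$ and satisfies $(u,k)\in K\iff r(u,k)\in L$ for all $u\in\Sigma_1^*$, $k\in\mathbb N$. Let $[L]^{\mathsf{fpt}}$ be the class of all parameterized problems that are fpt-reducible to $L$. Let $\Sigma^{\mathsf{func}}_{2,1}$ be the class of first-order sentences $\exists x_1\cdots\exists x_m\,\forall\bar y\;\psi$, where $m\ge 0$, $\bar y$ consists of at most one variable, and $\psi$ is quantifier-free, over arbitrary finite signatures of relation symbols (of positive arity) and function symbols (constants included). Let $\mathsf{pMC}(\Sigma^{\mathsf{func}}_{2,1})$ be the following problem: given a sentence $F\in\Sigma^{\mathsf{func}}_{2,1}$ and a finite structure $\mathcal A$ (with non-empty universe), with the length $|F|$ as the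 parameter, does $\mathcal A\models F$ hold? Let $\mathsf W^{\mathsf{func}}[2]=[\mathsf{pMC}(\Sigma^{\mathsf{func}}_{2,1})]^{\mathsf{fpt}}$. For $n\ge1$ let $T_n$ be the monoid of all maps from $\{1,\dots,n\}$ to itself under composition (evaluated from left to right). The problem $\mathsf{pF}[\mathsf T_*]$ is: given $n\ge 1$ (in unary), maps $a,a_1,\dots,a_m\in T_n$ (as lists of values) and $k\in\mathbb N$, the parameter, is $a\in\{a_1,\dots,a_m\}^k$, i.e. is $a$ a product of exactly $k$ factors from $\{a_1,\dots,a_m\}$, repetitions allowed? The problem $\mathsf{p\text{-}DFA\text{-}SW}$ is: given a deterministic finite automaton $A$ with a total transition function, and $k\in\mathbb N$, the parameter, is there a word $w$ of length at most $k$ that is synchronizing for $A$, i.e. takes all states of $A$ to one and the same state? Let $\mathsf W[\textsc{sync}]=[\mathsf{p\text{-}DFA\text{-}SW}]^{\mathsf{fpt}}$. **Theorem.** $\mathsf{pF}[\mathsf T_*]\in\mathsf W^{\mathsf{func}}[2]$, and $\mathsf W[\textsc{sync}]\subseteq\mathsf W^{\mathsf{func}}[2]$. -/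

import Mathlib

open scoped Pointwise

namespace PFact

/-! ### Parameterized problems and fpt-reductions -/

/-- A parameterized problem: a finite alphabet `Σ` and a subset of `Σ* × ℕ`. The second component
of a pair is the parameter. -/
structure ParamProblem where
  /-- the alphabet -/
  alphabet : Type
  [finite_alphabet : Finite alphabet]
  /-- the set of positive instances -/
  lang : Set (List alphabet × ℕ)

/-- The tape content for the pair `(u, k)`: the parameter `k` in unary (`k` copies of the extra
symbol `none`), followed by the word `u`. -/
def tape {Γ : Type} (x : List Γ × ℕ) : List (Option Γ) :=
  List.replicate x.2 none ++ x.1.map some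

/-- `K ≤ᶠᵖᵗ L`: there is a map `r (u, k) = (g u k, h k)` with `(u, k) ∈ K ↔ r (u, k) ∈ L` that a
(multi-stack) Turing machine computes in at most `p(|u|) · f(k)` steps, where `p` is a polynomial
and `f : ℕ → ℕ` is computable. (`r` is computable, hence so is `h`.) -/
def FptReducible (K L : ParamProblem) : Prop :=
  ∃ (g : List K.alphabet → ℕ → List L.alphabet) (h : ℕ → ℕ),
    Computable h ∧
    (∃ (M : Turing.TM2ComputableAux (Option K.alphabet) (Option L.alphabet))
        (p : Polynomial ℕ) (f : ℕ → ℕ),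
      Computable f ∧
      ∀ u k, Nonempty (Turing.TM2OutputsInTime M.tm
        ((tape (u, k)).map M.inputAlphabet.symm)
        (some ((tape (g u k, h k)).map M.outputAlphabet.symm))
        (p.eval u.length * f k))) ∧
    ∀ u k, (u, k) ∈ K.lang ↔ (g u k, h k) ∈ L.lang

/-- The fpt-closure `[L]ᶠᵖᵗ`: all parameterized problems that are fpt-reducible to `L`. -/
def fptClosure (L : ParamProblem) : Set ParamProblem :=
  {K | FptReducible K L}

/-! ### Words that encode inputs

An input is written down as a finite sequence of natural numbers (an item of variable length is
preceded by its length), and such a sequence `n₁, …, n_r` is encoded by the binary word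
`1^n₁ 0 ⋯ 1^n_r 0`. -/

/-- The word that encodes a sequence of natural numbers. -/
def word (l : List ℕ) : List Bool :=
  l.flatMap fun n => List.replicate n true ++ [false]

/-- The elements of a finite type `Fin n` listed along a tuple. -/
def tupleCode {a n : ℕ} (x : Fin a → Fin n) : List ℕ :=
  List.ofFn fun i => (x i : ℕ)

/-- The value table of an `a`-ary function on `Fin n`, arguments in lexicographic order. -/
def tableCode {n : ℕ} : (a : ℕ) → ((Fin a → Fin n) → Fin n) → List ℕ
  | 0, g => [(g Fin.elim0 : ℕ)]
  | a + 1, g => (List.finRange n).flatMap fun i => tableCode a fun v => g (Fin.cons i v)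

/-! ### Finite signatures and finite structures -/

/-- A finite signature: the list of the arities of its relation symbols (which are positive) and
the list of the arities of its function symbols (constants have arity `0`). -/
structure Signature where
  /-- arities of the relation symbols -/
  rel : List ℕ
  /-- arities of the function symbols -/
  fn : List ℕ
  rel_pos : ∀ n ∈ rel, 0 < n

/-- The first-order language of a signature. -/
def Signature.lang (σ : Signature) : FirstOrder.Language where
  Functions n := {i : Fin σ.fn.length // σ.fn.get i = n}
  Relations n := {i : Fin σ.rel.length // σ.rel.get i = n}

/-- A finite structure with the universe `{0, …, card - 1}`, as it is given to an algorithm: every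
relation is a list of tuples (in any order). -/
structure FinStr (σ : Signature) where
  /-- size of the universe -/
  card : ℕ
  card_pos : 0 < card
  /-- the tuples of each relation -/
  rels : ∀ i : Fin σ.rel.length, List (Fin (σ.rel.get i) → Fin card)
  /-- the functions -/
  funs : ∀ i : Fin σ.fn.length, (Fin (σ.fn.get i) → Fin card) → Fin card

/-- The structure in the sense of model theory. -/
@[reducible] def FinStr.str {σ : Signature} (A : FinStr σ) : σ.lang.Structure (Fin A.card) where
  funMap f x := A.funs f.1 fun j => x (Fin.cast f.2 j)
  RelMap r x := (fun j => x (Fin.cast r.2 j)) ∈ A.rels r.1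

/-! ### First-order formulas -/

/-- First-order formulas with the variables `x₀, x₁, …`. -/
inductive Fml (L : FirstOrder.Language.{0, 0}) : Type
  | rel {n : ℕ} (R : L.Relations n) (ts : Fin n → L.Term ℕ) : Fml L
  | eq (s t : L.Term ℕ) : Fml L
  | not (F : Fml L) : Fml L
  | and (F G : Fml L) : Fml L
  | or (F G : Fml L) : Fml L
  | ex (x : ℕ) (F : Fml L) : Fml L
  | all (x : ℕ) (F : Fml L) : Fml L

/-- The size of a term. -/
def termSize {L : FirstOrder.Language.{0, 0}} : L.Term ℕ → ℕ
  | .var _ => 1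
  | .func _ ts => 1 + ∑ i, termSize (ts i)

namespace Fml

variable {L : FirstOrder.Language.{0, 0}}

/-- The length of a formula. -/
def size : Fml L → ℕ
  | rel _ ts => 1 + ∑ i, termSize (ts i)
  | eq s t => 1 + termSize s + termSize t
  | not F => F.size + 1
  | and F G => F.size + G.size + 1
  | or F G => F.size + G.size + 1
  | ex _ F => F.size + 1
  | all _ F => F.size + 1

/-- The free variables of a formula. -/
def free : Fml L → Set ℕ
  | rel _ ts => {x | ∃ i, x ∈ (ts i).varFinset}
  | eq s t => {x | x ∈ s.varFinset ∨ x ∈ t.varFinset}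
  | not F => F.free
  | and F G => F.free ∪ G.free
  | or F G => F.free ∪ G.free
  | ex x F => F.free \ {x}
  | all x F => F.free \ {x}

/-- A sentence is a formula without free variables. -/
def IsSentence (F : Fml L) : Prop := F.free = ∅

/-- Formulas without quantifiers. -/
def QuantFree : Fml L → Prop
  | rel _ _ => True
  | eq _ _ => True
  | not F => F.QuantFree
  | and F G => F.QuantFree ∧ G.QuantFree
  | or F G => F.QuantFree ∧ G.QuantFree
  | ex _ _ => False
  | all _ _ => False

/-- Truth of a formula in a structure under an assignment of the variables. -/
def Realize {M : Type} [L.Structure M] : Fml L → (ℕ → M) → Prop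
  | rel R ts, v => FirstOrder.Language.Structure.RelMap R fun i => (ts i).realize v
  | eq s t, v => s.realize v = t.realize v
  | not F, v => ¬ F.Realize v
  | and F G, v => F.Realize v ∧ G.Realize v
  | or F G, v => F.Realize v ∨ G.Realize v
  | ex x F, v => ∃ a, F.Realize (Function.update v x a)
  | all x F, v => ∀ a, F.Realize (Function.update v x a)

/-- `Q x̄₁ Q' x̄₂ Q x̄₃ ⋯ ψ`, where the quantifiers of the blocks alternate and `Q` is `∃` if the
first argument is `true`, and `∀` otherwise. -/
def prenex : Bool → List (List ℕ) → Fml L → Fml L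
  | _, [], ψ => ψ
  | true, xs :: bs, ψ => xs.foldr ex (prenex false bs ψ)
  | false, xs :: bs, ψ => xs.foldr all (prenex true bs ψ)

end Fml

/-- `A ⊨ F` for a sentence `F`. -/
def Models {σ : Signature} (A : FinStr σ) (F : Fml σ.lang) : Prop :=
  letI := A.str
  ∀ v : ℕ → Fin A.card, F.Realize v

/-- The class `Σ^func_{l,u}`: sentences `∃ x̄₁ ∀ x̄₂ ⋯ Q_l x̄_l ψ` with `ψ` quantifier-free, in which
function symbols may occur and each of `x̄₂, …, x̄_l` has at most `u` variables. -/
def SigmaFunc (l u : ℕ) (σ : Signature) : Set (Fml σ.lang) :=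
  {F | F.IsSentence ∧ ∃ (blocks : List (List ℕ)) (ψ : Fml σ.lang),
    blocks.length = l ∧ (∀ b ∈ blocks.tail, b.length ≤ u) ∧ ψ.QuantFree ∧
      F = Fml.prenex true blocks ψ}

/-! ### Model checking and the classes `W^func[l]` -/

/-- Polish (prefix) notation for terms. -/
def termCode {σ : Signature} : σ.lang.Term ℕ → List ℕ
  | .var x => [0, x]
  | .func f ts => 1 :: (f.1 : ℕ) :: (List.ofFn fun i => termCode (ts i)).flatten

/-- Polish (prefix) notation for formulas. -/
def fmlCode {σ : Signature} : Fml σ.lang → List ℕ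
  | .rel R ts => 0 :: (R.1 : ℕ) :: (List.ofFn fun i => termCode (ts i)).flatten
  | .eq s t => 1 :: (termCode s ++ termCode t)
  | .not F => 2 :: fmlCode F
  | .and F G => 3 :: (fmlCode F ++ fmlCode G)
  | .or F G => 4 :: (fmlCode F ++ fmlCode G)
  | .ex x F => 5 :: x :: fmlCode F
  | .all x F => 6 :: x :: fmlCode F

/-- The arities of the relation symbols and of the function symbols. -/
def Signature.code (σ : Signature) : List ℕ :=
  σ.rel.length :: σ.rel ++ σ.fn.length :: σ.fn

/-- The size of the universe, the list of tuples of each relation, the table of each function. -/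
def FinStr.code {σ : Signature} (A : FinStr σ) : List ℕ :=
  A.card ::
    ((List.finRange σ.rel.length).flatMap (fun i =>
        (A.rels i).length :: (A.rels i).flatMap tupleCode) ++
      (List.finRange σ.fn.length).flatMap fun i => tableCode (σ.fn.get i) (A.funs i))

/-- `pMC(C)`: given a sentence `F ∈ C` and a finite structure `A`, with the length of `F` as
parameter, does `A ⊨ F` hold? -/
def pMC (C : ∀ σ : Signature, Set (Fml σ.lang)) : ParamProblem where
  alphabet := Bool
  lang := {x | ∃ (σ : Signature) (F : Fml σ.lang) (A : FinStr σ), F ∈ C σ ∧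
    x = (word (σ.code ++ fmlCode F ++ A.code), F.size) ∧ Models A F}

/-- `W^func[l]`, the fpt-closure of `pMC(Σ^func_{l,1})`. -/
def WFunc (l : ℕ) : Set ParamProblem :=
  fptClosure (pMC (SigmaFunc l 1))

/-! ### Factorization in transformation monoids -/

/-- The transformation monoid `T_n`: all maps on an `n`-element set. Products are evaluated from the
left to the right, so this is the opposite of `Function.End`. -/
abbrev Transf (n : ℕ) : Type := (Function.End (Fin n))ᵐᵒᵖ

/-- The list of values of a transformation. -/
def Transf.code {n : ℕ} (f : Transf n) : List ℕ :=
  tupleCode (a := n) (n := n) f.unop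

/-- `pF[T_*]`: given `n ≥ 1`, transformations `a, a₁, …, a_m ∈ T_n` and the parameter `k`, is
`a ∈ {a₁, …, a_m}^k`? -/
def pFT : ParamProblem where
  alphabet := Bool
  lang := {x | ∃ (n k : ℕ) (a : Transf n) (B : List (Transf n)), 1 ≤ n ∧
    x = (word (n :: a.code ++ B.length :: B.flatMap Transf.code), k) ∧
    a ∈ {b | b ∈ B} ^ k}

/-! ### Synchronizing words -/

/-- The numbers of states and letters, the initial state, the set of final states (as a
characteristic sequence), and the transition table. -/
noncomputable def dfaCode {s n : ℕ} (A : DFA (Fin s) (Fin n)) : List ℕ :=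
  open Classical in
  n :: s :: (A.start : ℕ) ::
    ((List.finRange n).map (fun q => if q ∈ A.accept then 1 else 0) ++
      (List.finRange n).flatMap fun q => (List.finRange s).map fun c => (A.step q c : ℕ))

/-- `w` is a synchronizing word: it takes all states to the same state. -/
def IsSynchronizing {α Q : Type} (A : DFA α Q) (w : List α) : Prop :=
  ∃ q, ∀ p, A.evalFrom p w = q

/-- `p-DFA-SW`: given a DFA `A` and the parameter `k`, is there a synchronizing word for `A` of
length at most `k`? -/
def pDFASW : ParamProblem where
  alphabet := Bool
  lang := {x | ∃ (s n k : ℕ) (A : DFA (Fin s) (Fin n)),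
    x = (word (dfaCode A), k) ∧ ∃ w : List (Fin s), w.length ≤ k ∧ IsSynchronizing A w}

/-- `W[sync]`, the fpt-closure of `p-DFA-SW`. -/
def WSync : Set ParamProblem :=
  fptClosure pDFASW

end PFact

/-! Both problems ask for a word of `k` actions on a finite set whose composition satisfies an
equation that can be tested point by point. With a binary function `d (letter, point)` the
composition is a single nested term, so the letters become existential variables and the tested
point is the only universal one. The equation `d(v₂, … d(v_{k+1}, c(v₀))) = a(v_r)` says for `r = 0`
that the product is the given map `a`; for `r = 1`, with `a` the identity, it says that the
composition is constant with value `v₁`.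

The structure has one sort, so numbers below its cardinality serve both as letters and as points,
and elements of the wrong kind must be harmless. The function `c` retracts the universe to the
points. For factorization, where the length is exactly `k`, a false letter sends everything to a
sink that is never a value of `a`. For synchronization, where the length is at most `k`, a false
letter acts as the identity and serves as padding. The lemmas `models_natTableStr`,
`Factor.mem_pFT_iff` and `Sync.mem_pDFASW_iff` make this precise, and `FptReducible.of_table` is the
common reduction. It relies on unique readability of the codes (`mem_pMC_iff`), because membership
in the model checking problem ranges over all ways to read a word.

The reductions have to be actual stack machines. Structured programs are compiled into machines with
the same step count (`Exec.simulate`). Above them, `Cmp` and `Gen` are classes of polynomial-time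
functions and word generators closed under arithmetic, bounded sums and bounded concatenation;
`Gen.exists_machine` turns a generator into a machine.

The inclusion for `WSync` follows from the reduction of `pDFASW` by transitivity
(`FptReducible.trans`). There two machines are composed, and the length of the intermediate word is
bounded by the number of push commands that the first machine can execute. -/

namespace PFact

open Turing Function

/-! ### Structured programs on stacks -/

/-- Structured programs that work on the stacks `0, 1, …` over the alphabet `Option Bool`. -/
inductive Prog : Type
  | skip : Prog
  | push (k : ℕ) (a : Option Bool) : Prog
  | seq (P Q : Prog) : Prog
  | case (k : ℕ) (P : Prog) (Q : Option Bool → Prog) : Prog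
  | loop (k : ℕ) (Q : Option Bool → Prog) : Prog

/-- The contents of the stacks. -/
abbrev Store : Type := ℕ → List (Option Bool)

/-- `Exec P S S' t`: started with the stacks `S`, the program `P` halts after `t` steps with the
stacks `S'`. Both `case` and `loop` pop the symbol on which they branch. -/
inductive Exec : Prog → Store → Store → ℕ → Prop
  | skip (S) : Exec .skip S S 1
  | push (k a S) : Exec (.push k a) S (update S k (a :: S k)) 1
  | seq {P Q S S' S'' t t'} : Exec P S S' t → Exec Q S' S'' t' → Exec (.seq P Q) S S'' (t + t')
  | case_nil {k P Q S S' t} : S k = [] → Exec P S S' t → Exec (.case k P Q) S S' (1 + t)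
  | case_cons {k P Q S S' t a l} : S k = a :: l → Exec (Q a) (update S k l) S' t →
      Exec (.case k P Q) S S' (1 + t)
  | loop_nil {k Q S} : S k = [] → Exec (.loop k Q) S S 1
  | loop_cons {k Q S S' S'' t t' a l} : S k = a :: l → Exec (Q a) (update S k l) S' t →
      Exec (.loop k Q) S' S'' t' → Exec (.loop k Q) S S'' (1 + t + t')

namespace Prog

/-- All stacks that occur in the program have an index below the bound. -/
def Below (b : ℕ) : Prog → Prop
  | skip => True
  | push k _ => k < b
  | seq P Q => P.Below b ∧ Q.Below b
  | case k P Q => k < b ∧ P.Below b ∧ ∀ a, (Q a).Below b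
  | loop k Q => k < b ∧ ∀ a, (Q a).Below b

theorem Below.mono {b c : ℕ} (h : b ≤ c) : ∀ {P : Prog}, P.Below b → P.Below c
  | skip, _ => trivial
  | push _ _, hP => lt_of_lt_of_le hP h
  | seq _ _, hP => ⟨hP.1.mono h, hP.2.mono h⟩
  | case _ _ _, hP => ⟨lt_of_lt_of_le hP.1 h, hP.2.1.mono h, fun a => (hP.2.2 a).mono h⟩
  | loop _ _, hP => ⟨lt_of_lt_of_le hP.1 h, fun a => (hP.2 a).mono h⟩

theorem exists_below_of_forall {Q : Option Bool → Prog} (h : ∀ a, ∃ b, (Q a).Below b) :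
    ∃ b, ∀ a, (Q a).Below b := by
  choose f hf using h
  exact ⟨∑ a, f a, fun a =>
    (hf a).mono (Finset.single_le_sum (f := f) (fun _ _ => Nat.zero_le _) (Finset.mem_univ a))⟩

theorem exists_below (P : Prog) : ∃ b, P.Below b := by
  induction P with
  | skip => exact ⟨0, trivial⟩
  | push k a => exact ⟨k + 1, Nat.lt_succ_self k⟩
  | seq P Q hP hQ =>
    obtain ⟨b, hb⟩ := hP
    obtain ⟨c, hc⟩ := hQ
    exact ⟨b + c, hb.mono (by omega), hc.mono (by omega)⟩
  | case k P Q hP hQ =>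
    obtain ⟨b, hb⟩ := hP
    obtain ⟨c, hc⟩ := exists_below_of_forall hQ
    exact ⟨b + c + k + 1, by omega, hb.mono (by omega), fun a => (hc a).mono (by omega)⟩
  | loop k Q hQ =>
    obtain ⟨c, hc⟩ := exists_below_of_forall hQ
    exact ⟨c + k + 1, by omega, fun a => (hc a).mono (by omega)⟩

/-- The labels of the machine that executes a program. -/
def Lab : Prog → Type
  | skip => Unit
  | push _ _ => Unit
  | seq P Q => P.Lab ⊕ Q.Lab
  | case _ P Q => Unit ⊕ (P.Lab ⊕ Σ a, (Q a).Lab)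
  | loop _ Q => Unit ⊕ Σ a, (Q a).Lab

theorem finite_lab : ∀ P : Prog, Finite P.Lab
  | skip => inferInstanceAs (Finite Unit)
  | push _ _ => inferInstanceAs (Finite Unit)
  | seq P Q =>
    have := P.finite_lab
    have := Q.finite_lab
    inferInstanceAs (Finite (P.Lab ⊕ Q.Lab))
  | case _ P Q =>
    have := P.finite_lab
    have := fun a => (Q a).finite_lab
    inferInstanceAs (Finite (Unit ⊕ (P.Lab ⊕ Σ a, (Q a).Lab)))
  | loop _ Q =>
    have := fun a => (Q a).finite_lab
    inferInstanceAs (Finite (Unit ⊕ Σ a, (Q a).Lab))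

/-- The label at which the execution starts. -/
def entry : (P : Prog) → P.Lab
  | skip => ()
  | push _ _ => ()
  | seq P _ => Sum.inl P.entry
  | case _ _ _ => Sum.inl ()
  | loop _ _ => Sum.inl ()

/-- The statements of the machine with `b + 1` stacks that executes a program. The labels of the
program are embedded by `ι`, and `out` is the label to which the program exits. -/
def code (b : ℕ) {Λ : Type} : (P : Prog) → (P.Lab → Λ) → Λ → P.Lab →
    TM2.Stmt (fun _ : Fin (b + 1) => Option Bool) Λ (Option (Option Bool))
  | skip, _, out, _ => .goto fun _ => out
  | push k a, _, out, _ => .push (Fin.ofNat (b + 1) k) (fun _ => a) (.goto fun _ => out)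
  | seq P Q, ι, _, .inl l => P.code b (fun x => ι (.inl x)) (ι (.inr Q.entry)) l
  | seq _ Q, ι, out, .inr l => Q.code b (fun x => ι (.inr x)) out l
  | case k P Q, ι, _, .inl _ => .pop (Fin.ofNat (b + 1) k) (fun _ x => x) (.goto fun v =>
      match v with
      | none => ι (.inr (.inl P.entry))
      | some a => ι (.inr (.inr ⟨a, (Q a).entry⟩)))
  | case _ P _, ι, out, .inr (.inl l) => P.code b (fun x => ι (.inr (.inl x))) out l
  | case _ _ Q, ι, out, .inr (.inr ⟨a, l⟩) =>
    (Q a).code b (fun x => ι (.inr (.inr ⟨a, x⟩))) out l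
  | loop k Q, ι, out, .inl _ => .pop (Fin.ofNat (b + 1) k) (fun _ x => x) (.goto fun v =>
      match v with
      | none => out
      | some a => ι (.inr ⟨a, (Q a).entry⟩))
  | loop _ Q, ι, _, .inr ⟨a, l⟩ => (Q a).code b (fun x => ι (.inr ⟨a, x⟩)) (ι (.inl ())) l

end Prog

/-! ### Simulation of programs by stack machines. -/

theorem restrict_update {b k : ℕ} (hk : k < b + 1) (S : Store) (x : List (Option Bool)) :
    (fun i : Fin (b + 1) => update S k x i) =
      update (fun i : Fin (b + 1) => S i) (Fin.ofNat (b + 1) k) x := by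
  funext i
  -- `Fin.ofNat` lets `Prog.code` do without bounds on stack indices; for indices in range nothing
  -- wraps around.
  have : Fin.ofNat (b + 1) k = ⟨k, hk⟩ := Fin.ext (by simp [Nat.mod_eq_of_lt hk])
  rw [this]
  by_cases h : (i : ℕ) = k
  · have : i = ⟨k, hk⟩ := Fin.ext h
    subst this
    simp
  · rw [update_of_ne h, update_of_ne (fun h' => h (by rw [h']))]

theorem restrict_apply {b k : ℕ} (hk : k < b + 1) (S : Store) :
    S (Fin.ofNat (b + 1) k : Fin (b + 1)) = S k := by
  simp [Nat.mod_eq_of_lt hk]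

theorem iterate_bind_add {σ : Type} {f : σ → Option σ} {m n : ℕ} {x y z : Option σ}
    (h : (flip bind f)^[m] x = y) (h' : (flip bind f)^[n] y = z) :
    (flip bind f)^[m + n] x = z := by
  rw [add_comm, iterate_add_apply, h, h']

theorem iterate_bind_push {b k : ℕ} (hk : k < b + 1) {Λ : Type}
    {M : Λ → TM2.Stmt (fun _ : Fin (b + 1) => Option Bool) Λ (Option (Option Bool))} {l : Λ}
    {a : Option Bool} {g} (h : M l = .push (Fin.ofNat (b + 1) k) (fun _ => a) (.goto g))
    (v : Option (Option Bool)) (S : Store) :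
    (flip bind (TM2.step M))^[1] (some ⟨some l, v, fun i => S i⟩) =
      some ⟨some (g v), v, fun i => update S k (a :: S k) i⟩ := by
  simp only [iterate_one, flip, Option.bind_eq_bind, Option.bind_some, TM2.step, h, TM2.stepAux]
  rw [restrict_update hk, restrict_apply hk S]

theorem iterate_bind_pop {b k : ℕ} (hk : k < b + 1) {Λ : Type}
    {M : Λ → TM2.Stmt (fun _ : Fin (b + 1) => Option Bool) Λ (Option (Option Bool))} {l : Λ}
    {g} (h : M l = .pop (Fin.ofNat (b + 1) k) (fun _ x => x) (.goto g))
    (v : Option (Option Bool)) (S : Store) :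
    (flip bind (TM2.step M))^[1] (some ⟨some l, v, fun i => S i⟩) =
      some ⟨some (g (S k).head?), (S k).head?, fun i => update S k (S k).tail i⟩ := by
  simp only [iterate_one, flip, Option.bind_eq_bind, Option.bind_some, TM2.step, h, TM2.stepAux]
  rw [restrict_update hk, restrict_apply hk S]

/-- Each push, pop or skip is one machine step and sequencing is free, so the step counts agree
exactly. The embedding `ι` and the exit `out` are arbitrary because a subprogram runs inside a
larger machine. The internal state may be arbitrary too: it is read only directly after a pop that
overwrites it. -/
theorem Exec.simulate {b : ℕ} {P : Prog} {S S' : Store} {t : ℕ} (h : Exec P S S' t) :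
    ∀ {Λ : Type} (M : Λ → TM2.Stmt (fun _ : Fin (b + 1) => Option Bool) Λ (Option (Option Bool)))
      (ι : P.Lab → Λ) (out : Λ), P.Below (b + 1) → (∀ l, M (ι l) = P.code b ι out l) →
      ∀ v, ∃ v', (flip bind (TM2.step M))^[t] (some ⟨some (ι P.entry), v, fun i => S i⟩) =
        some ⟨some out, v', fun i => S' i⟩ := by
  induction h with
  | skip S =>
    intro Λ M ι out _ hM v
    exact ⟨v, by simp [flip, TM2.step, hM, Prog.code]⟩
  | push k a S =>
    intro Λ M ι out hb hM v
    exact ⟨v, iterate_bind_push hb (hM ()) v S⟩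
  | @seq P Q _ _ _ _ _ _ _ ih ih' =>
    intro Λ M ι out hb hM v
    obtain ⟨v', h'⟩ := ih M (fun x => ι (.inl x)) (ι (.inr Q.entry)) hb.1 (fun l => hM (.inl l)) v
    obtain ⟨v'', h''⟩ := ih' M (fun x => ι (.inr x)) out hb.2 (fun l => hM (.inr l)) v'
    exact ⟨v'', iterate_bind_add h' h''⟩
  | @case_nil k P Q S _ _ hk _ ih =>
    intro Λ M ι out hb hM v
    obtain ⟨v', h'⟩ := ih M (fun x => ι (.inr (.inl x))) out hb.2.1
      (fun l => hM (.inr (.inl l))) none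
    refine ⟨v', iterate_bind_add (iterate_bind_pop hb.1 (hM (.inl ())) v S) ?_⟩
    -- Popping an empty stack changes nothing.
    rw [hk, List.tail_nil, ← hk, update_eq_self, hk]
    exact h'
  | @case_cons k P Q S _ _ a _ hk _ ih =>
    intro Λ M ι out hb hM v
    obtain ⟨v', h'⟩ := ih M (fun x => ι (.inr (.inr ⟨a, x⟩))) out (hb.2.2 a)
      (fun l => hM (.inr (.inr ⟨a, l⟩))) (some a)
    refine ⟨v', iterate_bind_add (iterate_bind_pop hb.1 (hM (.inl ())) v S) ?_⟩
    rw [hk]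
    exact h'
  | @loop_nil k Q S hk =>
    intro Λ M ι out hb hM v
    refine ⟨none, (iterate_bind_pop hb.1 (hM (.inl ())) v S).trans ?_⟩
    rw [hk, List.tail_nil, ← hk, update_eq_self, hk]
    rfl
  | @loop_cons k Q S _ _ _ _ a _ hk _ _ ih ih' =>
    intro Λ M ι out hb hM v
    -- The body exits to the head of the loop.
    obtain ⟨v', h'⟩ := ih M (fun x => ι (.inr ⟨a, x⟩)) (ι (.inl ())) (hb.2 a)
      (fun l => hM (.inr ⟨a, l⟩)) (some a)
    obtain ⟨v'', h''⟩ := ih' M ι out hb hM v'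
    refine ⟨v'', iterate_bind_add (iterate_bind_add
      (iterate_bind_pop hb.1 (hM (.inl ())) v S) ?_) h''⟩
    rw [hk]
    exact h'

/-- The machine that executes a program, with input on stack `0` and output on stack `1`. -/
noncomputable def Prog.machine (P : Prog) (b : ℕ) :
    TM2ComputableAux (Option Bool) (Option Bool) where
  tm :=
    { K := Fin (b + 1)
      k₀ := Fin.ofNat (b + 1) 0
      k₁ := Fin.ofNat (b + 1) 1
      Γ := fun _ => Option Bool
      Λ := Option P.Lab
      main := some P.entry
      ΛFin := by
        have := P.finite_lab
        exact Fintype.ofFinite _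
      σ := Option (Option Bool)
      initialState := none
      Γk₀Fin := inferInstanceAs (Fintype (Option Bool))
      m := fun l =>
        match l with
        | none => .load (fun _ => none) .halt
        | some l => P.code b some none l }
  inputAlphabet := Equiv.refl _
  outputAlphabet := Equiv.refl _

/-- The extra step is the one at the label `none`: a halting configuration must carry the initial
state, so the state is reset before the machine halts. -/
theorem Prog.outputsInTime {P : Prog} {b t T : ℕ} (hP : P.Below (b + 1)) (hb : 1 ≤ b)
    {x y : List (Option Bool)}
    (h : Exec P (update (fun _ => []) 0 x) (update (fun _ => []) 1 y) t) (ht : t + 1 ≤ T) :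
    Nonempty (TM2OutputsInTime (P.machine b).tm (x.map (P.machine b).inputAlphabet.symm)
      (some (y.map (P.machine b).outputAlphabet.symm)) T) := by
  obtain ⟨v', h'⟩ := h.simulate (P.machine b).tm.m some none hP (fun _ => rfl) none
  have hx : x.map (P.machine b).inputAlphabet.symm = x := List.map_id x
  have hy : y.map (P.machine b).outputAlphabet.symm = y := List.map_id y
  rw [hx, hy]
  have init : initList (P.machine b).tm x =
      ⟨some (some P.entry), none, fun i : Fin (b + 1) => update (fun _ => []) 0 x (i : ℕ)⟩ := by
    rw [restrict_update (b := b) (k := 0) (Nat.succ_pos b)]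
    simp only [initList]
    congr 1
    funext i
    by_cases hi : i = (P.machine b).tm.k₀
    · subst hi
      simp only [dif_pos]
      exact (update_self (β := fun _ => List (Option Bool)) _ x _).symm
    · rw [dif_neg hi]
      exact (update_of_ne (β := fun _ => List (Option Bool)) hi x
        (fun _ => [])).symm
  have fin : haltList (P.machine b).tm y =
      ⟨none, none, fun i : Fin (b + 1) => update (fun _ => []) 1 y (i : ℕ)⟩ := by
    rw [restrict_update (b := b) (k := 1) (by omega)]
    simp only [haltList]
    congr 1
    funext i
    by_cases hi : i = (P.machine b).tm.k₁
    · subst hi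
      simp only [dif_pos]
      exact (update_self (β := fun _ => List (Option Bool)) _ y _).symm
    · rw [dif_neg hi]
      exact (update_of_ne (β := fun _ => List (Option Bool)) hi y
        (fun _ => [])).symm
  refine ⟨⟨⟨t + 1, ?_⟩, ht⟩⟩
  rw [init]
  refine iterate_bind_add h' ?_
  change _ = some (haltList (P.machine b).tm y)
  rw [fin]
  rfl

/-! ### Polynomially bounded functions -/

/-- Functions that are bounded by a polynomial. -/
def PolyBdd (f : ℕ → ℕ) : Prop := ∃ c, ∀ M, f M ≤ (M + 2) ^ c

namespace PolyBdd

variable {f g : ℕ → ℕ}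

/-- The base `M + 2` is at least `2`, so that constants can be absorbed into the exponent. -/
theorem const (n : ℕ) : PolyBdd fun _ => n :=
  ⟨n, fun M => (Nat.lt_two_pow_self (n := n)).le.trans (Nat.pow_le_pow_left (by omega) n)⟩

theorem id : PolyBdd fun M => M := ⟨1, fun M => by simp⟩

theorem mul (hf : PolyBdd f) (hg : PolyBdd g) : PolyBdd fun M => f M * g M := by
  obtain ⟨c, hc⟩ := hf
  obtain ⟨d, hd⟩ := hg
  exact ⟨c + d, fun M => by rw [pow_add]; exact Nat.mul_le_mul (hc M) (hd M)⟩

theorem add (hf : PolyBdd f) (hg : PolyBdd g) : PolyBdd fun M => f M + g M := by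
  obtain ⟨c, hc⟩ := hf
  obtain ⟨d, hd⟩ := hg
  refine ⟨c + d + 1, fun M => ?_⟩
  have h1 : (M + 2) ^ c ≤ (M + 2) ^ (c + d) := Nat.pow_le_pow_right (by omega) (by omega)
  have h2 : (M + 2) ^ d ≤ (M + 2) ^ (c + d) := Nat.pow_le_pow_right (by omega) (by omega)
  calc f M + g M ≤ (M + 2) ^ (c + d) + (M + 2) ^ (c + d) :=
        add_le_add ((hc M).trans h1) ((hd M).trans h2)
    _ = (M + 2) ^ (c + d) * 2 := by ring
    _ ≤ (M + 2) ^ (c + d) * (M + 2) := Nat.mul_le_mul_left _ (by omega)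
    _ = (M + 2) ^ (c + d + 1) := (pow_succ _ _).symm

theorem pow (hf : PolyBdd f) (n : ℕ) : PolyBdd fun M => f M ^ n := by
  obtain ⟨c, hc⟩ := hf
  exact ⟨c * n, fun M => by rw [pow_mul]; exact Nat.pow_le_pow_left (hc M) n⟩

theorem mono (hg : PolyBdd g) (h : ∀ M, f M ≤ g M) : PolyBdd f := by
  obtain ⟨c, hc⟩ := hg
  exact ⟨c, fun M => (h M).trans (hc M)⟩

theorem comp (hf : PolyBdd f) (hg : PolyBdd g) : PolyBdd fun M => f (g M) := by
  obtain ⟨c, hc⟩ := hf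
  exact ((hg.add (const 2)).pow c).mono fun M => hc (g M)

end PolyBdd

/-! ### Execution within a time bound -/

/-- The program `P` transforms the stacks `S` into `S'` in at most `T` steps. -/
def Run (P : Prog) (S S' : Store) (T : ℕ) : Prop := ∃ t ≤ T, Exec P S S' t

namespace Run

variable {P Q : Prog} {S S' S'' : Store} {T T' : ℕ}

theorem mono (h : Run P S S' T) (hT : T ≤ T') : Run P S S' T' :=
  let ⟨t, ht, h⟩ := h
  ⟨t, ht.trans hT, h⟩

theorem seq (h : Run P S S' T) (h' : Run Q S' S'' T') : Run (.seq P Q) S S'' (T + T') :=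
  let ⟨t, ht, h⟩ := h
  let ⟨t', ht', h'⟩ := h'
  ⟨t + t', add_le_add ht ht', h.seq h'⟩

theorem skip (S : Store) : Run .skip S S 1 := ⟨1, le_rfl, .skip S⟩

theorem push (k : ℕ) (a : Option Bool) (S : Store) :
    Run (.push k a) S (update S k (a :: S k)) 1 := ⟨1, le_rfl, .push k a S⟩

theorem case_nil {k : ℕ} {Q : Option Bool → Prog} (hk : S k = []) (h : Run P S S' T) :
    Run (.case k P Q) S S' (1 + T) :=
  let ⟨t, ht, h⟩ := h
  ⟨1 + t, by omega, .case_nil hk h⟩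

theorem case_cons {k : ℕ} {Q : Option Bool → Prog} {a l} (hk : S k = a :: l)
    (h : Run (Q a) (update S k l) S' T) : Run (.case k P Q) S S' (1 + T) :=
  let ⟨t, ht, h⟩ := h
  ⟨1 + t, by omega, .case_cons hk h⟩

/-- A loop that empties a stack with the contents `l`. -/
theorem loop {k : ℕ} {Q : Option Bool → Prog} {T : ℕ} (l : List (Option Bool)) (F : ℕ → Store)
    (hF : ∀ m ≤ l.length, F m k = l.drop m)
    (h : ∀ m (hm : m < l.length), Run (Q l[m]) (update (F m) k (l.drop (m + 1))) (F (m + 1)) T) :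
    Run (.loop k Q) (F 0) (F l.length) (l.length * (T + 1) + 1) := by
  induction l generalizing F with
  | nil => exact ⟨1, by simp, .loop_nil (by simpa using hF 0 le_rfl)⟩
  | cons a l ih =>
    obtain ⟨t, ht, h0⟩ := h 0 (by simp)
    obtain ⟨t', ht', h'⟩ := ih (fun m => F (m + 1))
      (fun m hm => by simpa using hF (m + 1) (by simpa using hm))
      (fun m hm => h (m + 1) (by simpa using hm))
    refine ⟨1 + t + t', ?_, .loop_cons (a := a) (l := l) (by simpa using hF 0 (Nat.zero_le _))
      (by simpa using h0) (by simpa using h')⟩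
    simp only [List.length_cons]
    nlinarith

end Run

/-! ### Register programs

Stack `0` holds the input, stack `1` will hold the output, stack `2` is a scratch stack, stack `3`
collects the output in reverse order, and stack `j + 4` holds the number in register `j` in unary.
-/

/-- The stacks with input `i`, scratch stack `s`, reversed output `o` and registers `R`. -/
def cfg (i s o : List (Option Bool)) (R : ℕ → ℕ) : Store
  | 0 => i
  | 1 => []
  | 2 => s
  | 3 => o
  | j + 4 => List.replicate (R j) none

section cfg

variable (i s o x : List (Option Bool)) (R : ℕ → ℕ)

theorem update_cfg_zero : update (cfg i s o R) 0 x = cfg x s o R := by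
  funext k
  match k with
  | 0 => rfl
  | 1 => rfl
  | 2 => rfl
  | 3 => rfl
  | j + 4 => rfl

theorem update_cfg_two : update (cfg i s o R) 2 x = cfg i x o R := by
  funext k
  match k with
  | 0 => rfl
  | 1 => rfl
  | 2 => rfl
  | 3 => rfl
  | j + 4 => rfl

theorem update_cfg_three : update (cfg i s o R) 3 x = cfg i s x R := by
  funext k
  match k with
  | 0 => rfl
  | 1 => rfl
  | 2 => rfl
  | 3 => rfl
  | j + 4 => rfl

theorem update_cfg_reg (j n : ℕ) :
    update (cfg i s o R) (j + 4) (List.replicate n none) = cfg i s o (update R j n) := by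
  funext k
  match k with
  | 0 => rfl
  | 1 => rfl
  | 2 => rfl
  | 3 => rfl
  | l + 4 =>
    by_cases h : l = j
    · subst h
      simp [cfg]
    · simp [cfg, h]

end cfg

/-- Increment register `j`. -/
def inc (j : ℕ) : Prog := .push (j + 4) none

/-- Decrement register `j`. -/
def dec (j : ℕ) : Prog := .case (j + 4) .skip fun _ => .skip

/-- Decrement register `j` to `0` and execute `P` after each decrement. -/
def forReg (j : ℕ) (P : Prog) : Prog := .loop (j + 4) fun _ => P

section macros

variable {i s o : List (Option Bool)} {R R' : ℕ → ℕ}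

theorem run_inc (j : ℕ) (h : R' = update R j (R j + 1)) :
    Run (inc j) (cfg i s o R) (cfg i s o R') 1 := by
  rw [h, ← update_cfg_reg, List.replicate_succ]
  exact Run.push _ _ _

theorem run_dec (j : ℕ) (h : R' = update R j (R j - 1)) :
    Run (dec j) (cfg i s o R) (cfg i s o R') 2 := by
  rw [h]
  rcases hj : R j with _ | n
  · have : update R j (0 - 1) = R := by rw [← hj.trans (by rfl : 0 = 0 - 1), update_eq_self]
    rw [this]
    exact Run.case_nil (by simp [cfg, hj]) (Run.skip _)
  · refine Run.case_cons (T := 1) (a := none) (l := List.replicate n none) ?_ ?_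
    · simp [cfg, hj, List.replicate_succ]
    · rw [update_cfg_reg]
      exact Run.skip _

/-- The families describe the configuration after `m` rounds. The body starts after the counter has
been decremented, hence the `update`, and must leave the counter as it finds it. -/
theorem run_forReg {j n T : ℕ} {P : Prog} (I S O : ℕ → List (Option Bool)) (F : ℕ → ℕ → ℕ)
    (hF : ∀ m ≤ n, F m j = n - m)
    (h : ∀ m < n, Run P (cfg (I m) (S m) (O m) (update (F m) j (n - (m + 1))))
      (cfg (I (m + 1)) (S (m + 1)) (O (m + 1)) (F (m + 1))) T) :
    Run (forReg j P) (cfg (I 0) (S 0) (O 0) (F 0)) (cfg (I n) (S n) (O n) (F n))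
      (n * (T + 1) + 1) := by
  have := Run.loop (k := j + 4) (Q := fun _ => P) (T := T) (List.replicate n none)
    (fun m => cfg (I m) (S m) (O m) (F m))
    (fun m hm => by simp [cfg, hF m (by simpa using hm)])
    (fun m hm => by
      have := h m (by simpa using hm)
      simpa only [List.drop_replicate, update_cfg_reg] using this)
  simpa [forReg] using this

/-- Add register `j` to register `t` and clear it. -/
theorem run_move {j t n : ℕ} (hjt : j ≠ t) (hn : R j ≤ n)
    (h : R' = update (update R j 0) t (R t + R j)) :
    Run (forReg j (inc t)) (cfg i s o R) (cfg i s o R') (n * 2 + 1) := by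
  have := run_forReg (j := j) (n := R j) (T := 1) (P := inc t) (fun _ => i) (fun _ => s) (fun _ => o)
    (fun m => update (update R j (R j - m)) t (R t + m))
    (fun m _ => by simp [hjt])
    (fun m _ => run_inc t (by
      funext l
      simp only [update_apply]
      split_ifs <;> subst_vars <;> omega))
  refine Run.mono ?_ (Nat.succ_le_succ (Nat.mul_le_mul_right 2 hn))
  rw [h]
  simpa using this

/-- Clear register `j`. -/
theorem run_clear {j n : ℕ} (hn : R j ≤ n) (h : R' = update R j 0) :
    Run (forReg j .skip) (cfg i s o R) (cfg i s o R') (n * 2 + 1) := by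
  have := run_forReg (j := j) (n := R j) (T := 1) (P := .skip) (fun _ => i) (fun _ => s)
    (fun _ => o) (fun m => update R j (R j - m))
    (fun m _ => by simp)
    (fun m _ => by
      simp only [update_idem]
      exact Run.skip _)
  refine Run.mono ?_ (Nat.succ_le_succ (Nat.mul_le_mul_right 2 hn))
  rw [h]
  simpa using this

end macros

/-! ### Functions computed in polynomial time -/

/-- Evaluate an environment of variables that are held in the registers `ν`. -/
abbrev env {d : ℕ} (R : ℕ → ℕ) (ν : Fin d → ℕ) : Fin d → ℕ := fun i => R (ν i)

/-- The function `f` of a word and `d` numbers is computed by programs in polynomial time. The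
arguments are held in the registers `ν`, and the value is written to the register `t`. -/
def Cmp (d : ℕ) (f : List Bool → (Fin d → ℕ) → ℕ) : Prop :=
  ∃ B : ℕ → ℕ, PolyBdd B ∧ (∀ u ρ M, u.length ≤ M → (∀ i, ρ i ≤ M) → f u ρ ≤ B M) ∧
    ∀ (ν : Fin d → ℕ) (t : ℕ), (∀ i, ν i < t) → ∃ P : Prog, ∀ u o R M, u.length ≤ M →
      (∀ i, R (ν i) ≤ M) → (∀ j ≥ t, R j = 0) →
      Run P (cfg (u.map some) [] o R) (cfg (u.map some) [] o (update R t (f u (env R ν)))) (B M)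

/-- The word `G` that depends on a word and `d` numbers is produced by programs in polynomial
time. -/
def Gen (d : ℕ) (G : List Bool → (Fin d → ℕ) → List (Option Bool)) : Prop :=
  ∃ B : ℕ → ℕ, PolyBdd B ∧
    (∀ u ρ M, u.length ≤ M → (∀ i, ρ i ≤ M) → (G u ρ).length ≤ B M) ∧
    ∀ (ν : Fin d → ℕ) (t : ℕ), (∀ i, ν i < t) → ∃ P : Prog, ∀ u o R M, u.length ≤ M →
      (∀ i, R (ν i) ≤ M) → (∀ j ≥ t, R j = 0) →
      Run P (cfg (u.map some) [] o R) (cfg (u.map some) [] ((G u (env R ν)).reverse ++ o) R) (B M)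

theorem env_update {d t n : ℕ} {R : ℕ → ℕ} {ν : Fin d → ℕ} (h : ∀ i, ν i < t) :
    env (update R t n) ν = env R ν := by
  funext i
  exact update_of_ne (h i).ne _ _

/-- The value of a bit, `0` for positions beyond the end. -/
def bitAt (u : List Bool) (p : ℕ) : ℕ := (u[p]?.getD false).toNat

namespace Cmp

variable {d : ℕ} {f g : List Bool → (Fin d → ℕ) → ℕ}

theorem weaken (hf : Cmp d f) : Cmp (d + 1) fun u ρ => f u fun i => ρ i.castSucc := by
  obtain ⟨B, hB, hv, hr⟩ := hf
  refine ⟨B, hB, fun u ρ M hu hρ => hv u _ M hu fun i => hρ _, fun ν t hν => ?_⟩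
  obtain ⟨P, hP⟩ := hr (fun i => ν i.castSucc) t (fun i => hν _)
  exact ⟨P, fun u o R M hu hR hz => hP u o R M hu (fun i => hR _) hz⟩

/-- Reading a register in a loop destroys it. The value is therefore copied to both `t` and `t + 1`,
and the second copy is moved back. -/
theorem var (i : Fin d) : Cmp d fun _ ρ => ρ i := by
  refine ⟨fun M => M * (1 + 1 + 1) + 1 + (M * 2 + 1), ?_, ?_, ?_⟩
  · exact ((PolyBdd.id.mul (.const _)).add (.const 1)).add ((PolyBdd.id.mul (.const 2)).add (.const 1))
  · intro u ρ M _ hρ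
    exact (hρ i).trans (by dsimp only; omega)
  · intro ν t hν
    refine ⟨.seq (forReg (ν i) (.seq (inc t) (inc (t + 1)))) (forReg (t + 1) (inc (ν i))), ?_⟩
    intro u o R M hu hR hz
    have hi := hν i
    have h0 := hz t le_rfl
    have h1 := hz (t + 1) (by omega)
    have h := run_forReg (j := ν i) (n := R (ν i)) (P := .seq (inc t) (inc (t + 1)))
      (fun _ => u.map some) (fun _ => []) (fun _ => o)
      (fun m => update (update (update R (ν i) (R (ν i) - m)) t m) (t + 1) m)
      (fun m _ => by
        simp only [update_apply]
        split_ifs <;> subst_vars <;> omega)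
      (fun m _ => by
        refine Run.seq (run_inc t rfl) (run_inc (t + 1) ?_)
        funext l
        simp only [update_apply]
        split_ifs <;> subst_vars <;> omega)
    have hs : update (update (update R (ν i) (R (ν i) - 0)) t 0) (t + 1) 0 = R := by
      funext l
      simp only [update_apply]
      split_ifs <;> subst_vars <;> omega
    rw [hs] at h
    refine Run.seq (h.mono ?_) (run_move (j := t + 1) (t := ν i) (by omega) ?_ ?_)
    · exact Nat.succ_le_succ (Nat.mul_le_mul_right _ (hR i))
    · simpa using hR i
    · funext l
      simp only [update_apply, env]
      split_ifs <;> subst_vars <;> omega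

theorem const (n : ℕ) : Cmp d fun _ _ => n := by
  suffices h : ∀ t, ∃ P : Prog, ∀ i o R, R t = 0 →
      Run P (cfg i [] o R) (cfg i [] o (update R t n)) (n + 1) by
    refine ⟨fun _ => n + 1, .const _, fun _ _ _ _ _ => Nat.le_succ n, fun ν t _ => ?_⟩
    obtain ⟨P, hP⟩ := h t
    exact ⟨P, fun u o R M _ _ hz => hP _ o R (hz t le_rfl)⟩
  intro t
  induction n with
  | zero =>
    refine ⟨.skip, fun i o R h => ?_⟩
    rw [← h, update_eq_self]
    exact (Run.skip _).mono (by omega)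
  | succ n ih =>
    obtain ⟨P, hP⟩ := ih
    refine ⟨.seq P (inc t), fun i o R h => (hP i o R h).seq (run_inc t ?_)⟩
    simp

theorem add (hf : Cmp d f) (hg : Cmp d g) : Cmp d fun u ρ => f u ρ + g u ρ := by
  obtain ⟨B, hB, hv, hr⟩ := hf
  obtain ⟨B', hB', hv', hr'⟩ := hg
  refine ⟨fun M => B M + (B' M + (B' M * 2 + 1)),
    hB.add (hB'.add ((hB'.mul (.const 2)).add (.const 1))), ?_, ?_⟩
  · intro u ρ M hu hρ
    have := hv u ρ M hu hρ
    have := hv' u ρ M hu hρ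
    dsimp only
    omega
  · intro ν t hν
    obtain ⟨P, hP⟩ := hr ν t hν
    obtain ⟨P', hP'⟩ := hr' ν (t + 1) fun i => (hν i).trans (Nat.lt_succ_self t)
    refine ⟨.seq P (.seq P' (forReg (t + 1) (inc t))), fun u o R M hu hR hz => ?_⟩
    have h := hP u o R M hu hR hz
    have h' := hP' u o (update R t (f u (env R ν))) M hu
      (fun i => by rw [update_of_ne (hν i).ne]; exact hR i)
      (fun j hj => by rw [update_of_ne (by omega)]; exact hz j (by omega))
    rw [env_update hν] at h'
    refine h.seq (h'.seq (run_move (by omega) ?_ ?_))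
    · simpa using hv' u _ M hu hR
    · have h0 := hz t le_rfl
      have h1 := hz (t + 1) (by omega)
      funext l
      simp only [update_apply]
      split_ifs <;> subst_vars <;> omega

/-- Decrementing an empty register does nothing, which gives truncated subtraction. -/
theorem sub (hf : Cmp d f) (hg : Cmp d g) : Cmp d fun u ρ => f u ρ - g u ρ := by
  obtain ⟨B, hB, hv, hr⟩ := hf
  obtain ⟨B', hB', hv', hr'⟩ := hg
  refine ⟨fun M => B M + (B' M + (B' M * (2 + 1) + 1)),
    hB.add (hB'.add ((hB'.mul (.const _)).add (.const 1))), ?_, ?_⟩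
  · intro u ρ M hu hρ
    have := hv u ρ M hu hρ
    dsimp only
    omega
  · intro ν t hν
    obtain ⟨P, hP⟩ := hr ν t hν
    obtain ⟨P', hP'⟩ := hr' ν (t + 1) fun i => (hν i).trans (Nat.lt_succ_self t)
    refine ⟨.seq P (.seq P' (forReg (t + 1) (dec t))), fun u o R M hu hR hz => ?_⟩
    have h := hP u o R M hu hR hz
    have h' := hP' u o (update R t (f u (env R ν))) M hu
      (fun i => by rw [update_of_ne (hν i).ne]; exact hR i)
      (fun j hj => by rw [update_of_ne (by omega)]; exact hz j (by omega))
    rw [env_update hν] at h'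
    have h'' := run_forReg (j := t + 1) (n := g u (env R ν)) (T := 2) (P := dec t)
      (fun _ => u.map some) (fun _ => []) (fun _ => o)
      (fun m => update (update R t (f u (env R ν) - m)) (t + 1) (g u (env R ν) - m))
      (fun m _ => by simp)
      (fun m _ => run_dec t (by
        funext l
        simp only [update_apply]
        split_ifs <;> subst_vars <;> omega))
    refine h.seq (h'.seq ?_)
    have hb := hv' u (env R ν) M hu hR
    refine Run.mono ?_ (Nat.succ_le_succ (Nat.mul_le_mul_right _ hb))
    have h1 := hz (t + 1) (by omega)
    have he : update (update R t (f u (env R ν) - g u (env R ν))) (t + 1)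
        (g u (env R ν) - g u (env R ν)) = update R t (f u (env R ν) - g u (env R ν)) := by
      funext l
      simp only [update_apply]
      split_ifs <;> subst_vars <;> omega
    simp only [he] at h''
    exact h''

/-- The input is unwound onto the scratch stack, the symbol on top is inspected and replaced, and
the input is rewound. Beyond the end the pops have no effect, which yields the default value `0`. -/
theorem bit (hf : Cmp d f) : Cmp d fun u ρ => bitAt u (f u ρ) := by
  obtain ⟨B, hB, hv, hr⟩ := hf
  refine ⟨fun M => B M + ((B M * (2 + 1) + 1) + (3 + ((B M + M) * (1 + 1) + 1))), ?_, ?_, ?_⟩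
  · exact hB.add (((hB.mul (.const _)).add (.const 1)).add ((PolyBdd.const 3).add
      (((hB.add .id).mul (.const 2)).add (.const 1))))
  · intro u ρ M _ _
    have : bitAt u (f u ρ) ≤ 1 := Bool.toNat_le _
    dsimp only
    omega
  · intro ν t hν
    -- The position goes to `t + 1`, so that `t` is still zero when it receives the bit.
    obtain ⟨P, hP⟩ := hr ν (t + 1) fun i => (hν i).trans (Nat.lt_succ_self t)
    refine ⟨.seq P (.seq (forReg (t + 1) (.case 0 .skip fun a => .push 2 a)) (.seq
      (.case 0 .skip fun a => .seq (.push 0 a) (if a = some true then inc t else .skip))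
      (.loop 2 fun a => .push 0 a))), fun u o R M hu hR hz => ?_⟩
    have h := hP u o R M hu hR fun j hj => hz j (by omega)
    have hb := hv u (env R ν) M hu hR
    set n := f u (env R ν)
    have h0 := hz t le_rfl
    have h1 := hz (t + 1) (by omega)
    -- move `n` symbols to the scratch stack
    have h2 := run_forReg (j := t + 1) (n := n) (T := 2) (P := .case 0 .skip fun a => .push 2 a)
      (fun m => (u.map some).drop m) (fun m => ((u.map some).take m).reverse) (fun _ => o)
      (fun m => update R (t + 1) (n - m))
      (fun m _ => by simp)
      (fun m _ => by
        rw [update_idem]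
        rcases lt_or_ge m (u.map some).length with hm | hm
        · have e := List.drop_eq_getElem_cons hm
          refine Run.case_cons (T := 1) (a := (u.map some)[m]) (l := (u.map some).drop (m + 1)) ?_ ?_
          · exact e
          · rw [update_cfg_zero]
            have := Run.push 2 (u.map some)[m] (cfg ((u.map some).drop (m + 1))
              ((u.map some).take m).reverse o (update R (t + 1) (n - (m + 1))))
            rw [update_cfg_two] at this
            convert this using 2
            rw [List.take_succ_eq_append_getElem hm]
            simp [cfg]
        · have e : (u.map some).drop m = [] := List.drop_eq_nil_of_le hm
          have e' : (u.map some).drop (m + 1) = [] := List.drop_eq_nil_of_le (by omega)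
          rw [e, e', List.take_of_length_le hm, List.take_of_length_le (by omega : _ ≤ m + 1)]
          exact Run.case_nil rfl (Run.skip _))
    have e2 : update R (t + 1) (n - n) = R := by
      rw [Nat.sub_self, ← h1, update_eq_self]
    simp only [e2] at h2
    -- test the next symbol
    have h3 : Run (.case 0 .skip fun a => .seq (.push 0 a) (if a = some true then inc t else .skip))
        (cfg ((u.map some).drop n) ((u.map some).take n).reverse o R)
        (cfg ((u.map some).drop n) ((u.map some).take n).reverse o (update R t (bitAt u n))) 3 := by
      rcases lt_or_ge n u.length with hm | hm
      · have e : (u.map some).drop n = some u[n] :: (u.map some).drop (n + 1) := by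
          rw [List.drop_eq_getElem_cons (by simpa using hm), List.getElem_map]
        rw [e]
        refine Run.case_cons (T := 2) rfl ?_
        rw [update_cfg_zero]
        have := Run.push 0 (some u[n]) (cfg ((u.map some).drop (n + 1))
              ((u.map some).take n).reverse o R)
        rw [update_cfg_zero] at this
        refine Run.seq (T := 1) (T' := 1) this ?_
        simp only [Option.some.injEq, bitAt, List.getElem?_eq_getElem hm, Option.getD_some]
        split_ifs with hbit
        · exact run_inc t (by simp [hbit, h0])
        · have : update R t (u[n]).toNat = R := by
            rw [Bool.eq_false_of_not_eq_true hbit]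
            rw [Bool.toNat_false, ← h0, update_eq_self]
          rw [this]
          exact Run.skip _
      · have e : (u.map some).drop n = [] := List.drop_eq_nil_of_le (by simpa using hm)
        have : update R t (bitAt u n) = R := by
          rw [bitAt, List.getElem?_eq_none hm, Option.getD_none, Bool.toNat_false, ← h0,
            update_eq_self]
        rw [e, this]
        exact (Run.case_nil rfl (Run.skip _)).mono (by omega)
    -- move the symbols back
    have h4 := Run.loop (k := 2) (Q := fun a => .push 0 a) (T := 1) ((u.map some).take n).reverse
      (fun m => cfg ((((u.map some).take n).reverse.take m).reverse ++ (u.map some).drop n)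
        (((u.map some).take n).reverse.drop m) o (update R t (bitAt u n)))
      (fun m _ => rfl)
      (fun m hm => by
        rw [update_cfg_two]
        have := Run.push 0 (((u.map some).take n).reverse)[m]
          (cfg ((((u.map some).take n).reverse.take m).reverse ++ (u.map some).drop n)
            (((u.map some).take n).reverse.drop (m + 1)) o (update R t (bitAt u n)))
        rw [update_cfg_zero] at this
        convert this using 2
        rw [List.take_succ_eq_append_getElem hm]
        simp [cfg])
    simp only [List.take_zero, List.reverse_nil, List.nil_append, List.drop_zero, List.take_length,
      List.reverse_reverse, List.take_append_drop, List.drop_length] at h4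
    refine h.seq (Run.seq ?_ (h3.seq (h4.mono ?_)))
    · refine Run.mono ?_ (Nat.succ_le_succ (Nat.mul_le_mul_right _ hb))
      simpa using h2
    · refine Nat.succ_le_succ (Nat.mul_le_mul_right _ ?_)
      simp
      omega

end Cmp

theorem snoc_lt {d t m n : ℕ} {ν : Fin d → ℕ} (hν : ∀ i, ν i < t) (hm : m < n) (ht : t ≤ n)
    (i : Fin (d + 1)) : (Fin.snoc ν m : Fin (d + 1) → ℕ) i < n := by
  refine Fin.lastCases ?_ (fun i => ?_) i
  · simpa using hm
  · simpa using (hν i).trans_le ht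

theorem env_snoc {d m : ℕ} (R : ℕ → ℕ) (ν : Fin d → ℕ) :
    env R (Fin.snoc ν m : Fin (d + 1) → ℕ) = (Fin.snoc (env R ν) (R m) : Fin (d + 1) → ℕ) := by
  funext i
  refine Fin.lastCases ?_ (fun i => ?_) i <;> simp [env]

/-- Register `t` accumulates, `t + 1` counts the bound down, `t + 2` counts the index up and is the
last argument of the summand, and `t + 3` receives the summand. Indices are below `B M`, so the
summand is evaluated on arguments of size at most `M + B M`. Products, bounded quantifiers and the
decoding of words are all instances of such sums. -/
theorem Cmp.sum {d : ℕ} {f : List Bool → (Fin d → ℕ) → ℕ} {g : List Bool → (Fin d → ℕ) → ℕ → ℕ}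
    (hf : Cmp d f) (hg : Cmp (d + 1) fun u ρ => g u (fun i => ρ i.castSucc) (ρ (Fin.last d))) :
    Cmp d fun u ρ => ∑ i ∈ Finset.range (f u ρ), g u ρ i := by
  obtain ⟨B, hB, hv, hr⟩ := hf
  obtain ⟨B', hB', hv', hr'⟩ := hg
  refine ⟨fun M => B M * B' (M + B M) + (B M + (B M * (B' (M + B M) + (B' (M + B M) * 2 + 1 + 1) + 1)
    + 1 + (B M * 2 + 1))), ?_, ?_, ?_⟩
  · have h := hB'.comp (PolyBdd.id.add hB)
    exact (hB.mul h).add (hB.add (((hB.mul ((h.add (((h.mul (.const 2)).add (.const 1)).add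
      (.const 1))).add (.const 1))).add (.const 1)).add ((hB.mul (.const 2)).add (.const 1))))
  · intro u ρ M hu hρ
    have h := hv u ρ M hu hρ
    refine le_trans ?_ (Nat.le_add_right _ _)
    refine le_trans (Finset.sum_le_card_nsmul _ _ (B' (M + B M)) fun i hi => ?_) ?_
    · have := hv' u (Fin.snoc ρ i : Fin (d + 1) → ℕ) (M + B M) (by omega) fun j => ?_
      · simpa using this
      · refine Fin.lastCases ?_ (fun j => ?_) j
        · have := Finset.mem_range.1 hi
          simp only [Fin.snoc_last]
          omega
        · simpa using (hρ j).trans (Nat.le_add_right _ _)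
    · simpa using Nat.mul_le_mul_right _ h
  · intro ν t hν
    obtain ⟨P, hP⟩ := hr ν (t + 1) fun i => (hν i).trans (Nat.lt_succ_self t)
    obtain ⟨P', hP'⟩ := hr' (Fin.snoc ν (t + 2)) (t + 3) (snoc_lt hν (by omega) (by omega))
    refine ⟨.seq P (.seq (forReg (t + 1) (.seq P' (.seq (forReg (t + 3) (inc t)) (inc (t + 2)))))
      (forReg (t + 2) .skip)), fun u o R M hu hR hz => ?_⟩
    have h := hP u o R M hu hR fun j hj => hz j (by omega)
    have hb := hv u (env R ν) M hu hR
    set n := f u (env R ν)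
    have h0 := hz t le_rfl
    have h1 := hz (t + 1) (by omega)
    have h2 := hz (t + 2) (by omega)
    have h3 := hz (t + 3) (by omega)
    have hM : M ≤ M + B M := Nat.le_add_right _ _
    let s : ℕ → ℕ := fun m => ∑ i ∈ Finset.range m, g u (env R ν) i
    have hs : ∀ m, s (m + 1) = s m + g u (env R ν) m := fun m => Finset.sum_range_succ _ _
    have hs0 : s 0 = 0 := rfl
    have h' := run_forReg (j := t + 1) (n := n)
      (T := B' (M + B M) + (B' (M + B M) * 2 + 1 + 1))
      (P := .seq P' (.seq (forReg (t + 3) (inc t)) (inc (t + 2))))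
      (fun _ => u.map some) (fun _ => []) (fun _ => o)
      (fun m => update (update (update R t (s m)) (t + 1) (n - m)) (t + 2) m)
      (fun m _ => by simp)
      (fun m hm => by
        set R' := update (update (update (update R t (s m)) (t + 1) (n - m)) (t + 2) m) (t + 1)
          (n - (m + 1)) with hR'
        have e : env R' ν = env R ν := by
          rw [hR', env_update fun i => (hν i).trans (by omega),
            env_update fun i => (hν i).trans (by omega),
            env_update fun i => (hν i).trans (by omega), env_update hν]
        have e2 : R' (t + 2) = m := by simp [hR']
        have ha : ∀ i, env R' (Fin.snoc ν (t + 2) : Fin (d + 1) → ℕ) i ≤ M + B M := by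
          rw [env_snoc, e, e2]
          refine Fin.lastCases ?_ (fun i => ?_)
          · simp only [Fin.snoc_last]
            omega
          · simpa using (hR i).trans hM
        have hv := hv' u _ (M + B M) (by omega) ha
        have hr := hP' u o R' (M + B M) (by omega) ha (fun j hj => by
          rw [hR', update_of_ne (by omega), update_of_ne (by omega), update_of_ne (by omega),
            update_of_ne (by omega)]
          exact hz j (by omega))
        rw [env_snoc, e, e2] at hr hv
        simp only [Fin.snoc_castSucc, Fin.snoc_last] at hr hv
        refine hr.seq (Run.seq (run_move (by omega) ?_ rfl) (run_inc _ ?_))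
        · simpa using hv
        · have := hs m
          funext l
          simp only [hR', update_apply]
          split_ifs <;> subst_vars <;> omega)
    have e0 : update (update (update R t (s 0)) (t + 1) (n - 0)) (t + 2) 0 = update R (t + 1) n := by
      funext l
      simp only [update_apply]
      split_ifs <;> subst_vars <;> omega
    rw [e0] at h'
    refine Run.mono (h.seq (h'.seq (run_clear (n := B M) (by simpa using hb) ?_))) ?_
    · funext l
      simp only [update_apply]
      split_ifs <;> subst_vars <;> try omega
      rfl
    · refine le_trans (Nat.add_le_add_left ?_ _) (Nat.le_add_left _ _)
      exact Nat.add_le_add_right (Nat.succ_le_succ (Nat.mul_le_mul_right _ hb)) _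

namespace Gen

variable {d : ℕ} {G H : List Bool → (Fin d → ℕ) → List (Option Bool)}

theorem nil : Gen d fun _ _ => [] :=
  ⟨fun _ => 1, .const 1, fun _ _ _ _ _ => Nat.zero_le _,
    fun _ _ _ => ⟨.skip, fun _ _ _ _ _ _ _ => Run.skip _⟩⟩

theorem singleton (a : Option Bool) : Gen d fun _ _ => [a] := by
  refine ⟨fun _ => 1, .const 1, fun _ _ _ _ _ => le_rfl,
    fun ν t _ => ⟨.push 3 a, fun u o R M _ _ _ => ?_⟩⟩
  have := Run.push 3 a (cfg (u.map some) [] o R)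
  rwa [update_cfg_three] at this

theorem append (hG : Gen d G) (hH : Gen d H) : Gen d fun u ρ => G u ρ ++ H u ρ := by
  obtain ⟨B, hB, hl, hr⟩ := hG
  obtain ⟨B', hB', hl', hr'⟩ := hH
  refine ⟨fun M => B M + B' M, hB.add hB', fun u ρ M hu hρ => ?_, fun ν t hν => ?_⟩
  · rw [List.length_append]
    exact add_le_add (hl u ρ M hu hρ) (hl' u ρ M hu hρ)
  · obtain ⟨P, hP⟩ := hr ν t hν
    obtain ⟨P', hP'⟩ := hr' ν t hν
    refine ⟨.seq P P', fun u o R M hu hR hz => ?_⟩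
    have := (hP u o R M hu hR hz).seq (hP' u _ R M hu hR hz)
    rwa [← List.append_assoc, ← List.reverse_append] at this

/-- The loop is that of `Cmp.sum` without an accumulator. The output is collected in reverse, so
later pieces are simply pushed on top of earlier ones. -/
theorem flatMap {f : List Bool → (Fin d → ℕ) → ℕ}
    {G : List Bool → (Fin d → ℕ) → ℕ → List (Option Bool)} (hf : Cmp d f)
    (hG : Gen (d + 1) fun u ρ => G u (fun i => ρ i.castSucc) (ρ (Fin.last d))) :
    Gen d fun u ρ => (List.range (f u ρ)).flatMap (G u ρ) := by
  obtain ⟨B, hB, hv, hr⟩ := hf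
  obtain ⟨B', hB', hv', hr'⟩ := hG
  refine ⟨fun M => B M * B' (M + B M) + (B M + (B M * (B' (M + B M) + 1 + 1)
    + 1 + (B M * 2 + 1))), ?_, ?_, ?_⟩
  · have h := hB'.comp (PolyBdd.id.add hB)
    exact (hB.mul h).add (hB.add (((hB.mul ((h.add (.const 1)).add (.const 1))).add
      (.const 1)).add ((hB.mul (.const 2)).add (.const 1))))
  · intro u ρ M hu hρ
    have h := hv u ρ M hu hρ
    refine le_trans ?_ (Nat.le_add_right _ _)
    rw [List.length_flatMap]
    refine le_trans (List.sum_le_card_nsmul _ (B' (M + B M)) fun x hx => ?_) ?_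
    · obtain ⟨i, hi, rfl⟩ := List.mem_map.1 hx
      have := hv' u (Fin.snoc ρ i : Fin (d + 1) → ℕ) (M + B M) (by omega) fun j => ?_
      · simpa using this
      · refine Fin.lastCases ?_ (fun j => ?_) j
        · have := List.mem_range.1 hi
          simp only [Fin.snoc_last]
          omega
        · simpa using (hρ j).trans (Nat.le_add_right _ _)
    · simpa using Nat.mul_le_mul_right _ h
  · intro ν t hν
    obtain ⟨P, hP⟩ := hr ν t hν
    obtain ⟨P', hP'⟩ := hr' (Fin.snoc ν (t + 1)) (t + 2) (snoc_lt hν (by omega) (by omega))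
    refine ⟨.seq P (.seq (forReg t (.seq P' (inc (t + 1)))) (forReg (t + 1) .skip)),
      fun u o R M hu hR hz => ?_⟩
    have h := hP u o R M hu hR hz
    have hb := hv u (env R ν) M hu hR
    set n := f u (env R ν)
    have h0 := hz t le_rfl
    have h1 := hz (t + 1) (by omega)
    have h2 := hz (t + 2) (by omega)
    have hM : M ≤ M + B M := Nat.le_add_right _ _
    have h' := run_forReg (j := t) (n := n) (T := B' (M + B M) + 1) (P := .seq P' (inc (t + 1)))
      (fun _ => u.map some) (fun _ => [])
      (fun m => ((List.range m).flatMap (G u (env R ν))).reverse ++ o)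
      (fun m => update (update R t (n - m)) (t + 1) m)
      (fun m _ => by simp)
      (fun m hm => by
        set R' := update (update (update R t (n - m)) (t + 1) m) t (n - (m + 1)) with hR'
        have e : env R' ν = env R ν := by
          rw [hR', env_update hν, env_update fun i => (hν i).trans (by omega), env_update hν]
        have e2 : R' (t + 1) = m := by simp [hR']
        have ha : ∀ i, env R' (Fin.snoc ν (t + 1) : Fin (d + 1) → ℕ) i ≤ M + B M := by
          rw [env_snoc, e, e2]
          refine Fin.lastCases ?_ (fun i => ?_)
          · simp only [Fin.snoc_last]
            omega
          · simpa using (hR i).trans hM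
        have hr := hP' u (((List.range m).flatMap (G u (env R ν))).reverse ++ o) R' (M + B M)
          (by omega) ha (fun j hj => by
            rw [hR', update_of_ne (by omega), update_of_ne (by omega), update_of_ne (by omega)]
            exact hz j (by omega))
        rw [env_snoc, e, e2] at hr
        simp only [Fin.snoc_castSucc, Fin.snoc_last] at hr
        have ho : ((List.range (m + 1)).flatMap (G u (env R ν))).reverse ++ o =
            (G u (env R ν) m).reverse ++ (((List.range m).flatMap (G u (env R ν))).reverse ++ o) := by
          simp [List.range_succ]
        rw [ho]
        refine hr.seq (run_inc _ ?_)
        funext l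
        simp only [hR', update_apply]
        split_ifs <;> subst_vars <;> omega)
    have e0 : update (update R t (n - 0)) (t + 1) 0 = update R t n := by
      funext l
      simp only [update_apply]
      split_ifs <;> subst_vars <;> omega
    rw [e0] at h'
    refine Run.mono (h.seq (h'.seq (run_clear (n := B M) (by simpa using hb) ?_))) ?_
    · funext l
      simp only [update_apply]
      split_ifs <;> subst_vars <;> omega
    · refine le_trans (Nat.add_le_add_left ?_ _) (Nat.le_add_left _ _)
      exact Nat.add_le_add_right (Nat.succ_le_succ (Nat.mul_le_mul_right _ hb)) _

end Gen

/-! ### Machines for generated words -/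

/-- Move the parameter to register `0`. -/
def readTape : Prog :=
  .seq (.loop 0 fun a => match a with
      | none => inc 0
      | some b => .push 2 (some b))
    (.loop 2 fun a => .push 0 a)

/-- The invariant of the first loop is a filter for the word and a count for the parameter; neither
depends on how the symbols are arranged. The second loop undoes the reversal caused by the scratch
stack. -/
theorem run_readTape (u : List Bool) (k : ℕ) :
    Run readTape (cfg (tape (u, k)) [] [] fun _ => 0)
      (cfg (u.map some) [] [] (update (fun _ => 0) 0 k))
      ((u.length + k) * (1 + 1) + 1 + ((u.length + k) * (1 + 1) + 1)) := by
  set x := tape (u, k) with hx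
  have hlen : x.length = u.length + k := by simp [hx, tape, add_comm]
  have hfil : x.filter Option.isSome = u.map some := by
    rw [hx, tape, List.filter_append, List.filter_eq_nil_iff.2 (by simp), List.nil_append,
      List.filter_eq_self.2 fun a ha => by
        obtain ⟨b, _, rfl⟩ := List.mem_map.1 ha
        rfl]
  have hcount : x.count none = k := by
    rw [hx, tape, List.count_append, List.count_replicate_self, List.count_eq_zero.2 (by simp),
      add_zero]
  have h := Run.loop (k := 0) (T := 1) (Q := fun a => match a with
      | none => inc 0
      | some b => .push 2 (some b)) x
    (fun m => cfg (x.drop m) ((x.take m).filter Option.isSome).reverse []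
      (update (fun _ => 0) 0 ((x.take m).count none)))
    (fun m _ => rfl)
    (fun m hm => by
      rw [update_cfg_zero, List.take_succ_eq_append_getElem hm]
      rcases hxm : x[m] with _ | b
      · have e : (x.take m ++ [none]).filter Option.isSome = (x.take m).filter Option.isSome := by
          simp
        rw [e]
        exact run_inc 0 (by simp)
      · have := Run.push 2 (some b) (cfg (x.drop (m + 1))
          ((x.take m).filter Option.isSome).reverse [] (update (fun _ => 0) 0 ((x.take m).count none)))
        rw [update_cfg_two] at this
        simpa [cfg] using this)
  have h' := Run.loop (k := 2) (T := 1) (Q := fun a => .push 0 a) (u.map some).reverse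
    (fun m => cfg (((u.map some).reverse.take m).reverse) ((u.map some).reverse.drop m) []
      (update (fun _ => 0) 0 k))
    (fun m _ => rfl)
    (fun m hm => by
      rw [update_cfg_two]
      have := Run.push 0 ((u.map some).reverse)[m]
        (cfg ((((u.map some).reverse).take m).reverse) ((u.map some).reverse.drop (m + 1)) []
          (update (fun _ => 0) 0 k))
      rw [update_cfg_zero] at this
      rw [List.take_succ_eq_append_getElem hm, List.reverse_append]
      exact this)
  simp only [List.drop_zero, List.take_zero, List.filter_nil, List.reverse_nil, List.count_nil,
    List.take_length, List.drop_length, hfil, hcount, List.reverse_reverse] at h h'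
  simp only [hlen, List.length_reverse, List.length_map] at h h'
  rw [show update (fun _ : ℕ => 0) 0 0 = fun _ => 0 from update_eq_self 0 _] at h
  exact h.seq (h'.mono (by omega))

/-- Move the collected output to the output stack. -/
theorem run_writeOutput (o : List (Option Bool)) :
    Run (.loop 3 fun a => .push 1 a) (cfg [] [] o fun _ => 0) (update (fun _ => []) 1 o.reverse)
      (o.length * (1 + 1) + 1) := by
  have hc : ∀ x, update (cfg [] [] [] fun _ => 0) 1 x = update (fun _ => []) 1 x := by
    intro x
    congr 1
    funext k
    match k with
    | 0 => rfl
    | 1 => rfl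
    | 2 => rfl
    | 3 => rfl
    | j + 4 => rfl
  have h := Run.loop (k := 3) (T := 1) (Q := fun a => .push 1 a) o
    (fun m => update (cfg [] [] (o.drop m) fun _ => 0) 1 (o.take m).reverse)
    (fun m _ => rfl)
    (fun m hm => by
      rw [update_comm (by omega), update_cfg_three]
      have := Run.push 1 o[m] (update (cfg [] [] (o.drop (m + 1)) fun _ => 0) 1 (o.take m).reverse)
      simp only [update_idem, update_self] at this
      rw [List.take_succ_eq_append_getElem hm, List.reverse_append]
      exact this)
  simp only [List.drop_zero, List.take_zero, List.reverse_nil, List.take_length,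
    List.drop_length, hc] at h
  rwa [show update (cfg [] [] o fun _ => 0) 1 [] = cfg [] [] o fun _ => 0 from
    update_eq_self 1 _] at h

theorem run_loop_skip (k : ℕ) (S : Store) :
    Run (.loop k fun _ => .skip) S (update S k []) ((S k).length * 2 + 1) := by
  have h := Run.loop (k := k) (T := 1) (Q := fun _ => .skip) (S k)
    (fun m => update S k ((S k).drop m)) (fun m _ => by simp)
    (fun m hm => by
      rw [update_idem]
      exact Run.skip _)
  simpa using h

theorem Gen.exists_machine {G : List Bool → (Fin 1 → ℕ) → List (Option Bool)} (hG : Gen 1 G) :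
    ∃ (M : TM2ComputableAux (Option Bool) (Option Bool)) (c : ℕ), ∀ u k,
      Nonempty (TM2OutputsInTime M.tm ((tape (u, k)).map M.inputAlphabet.symm)
        (some ((G u ![k]).map M.outputAlphabet.symm)) ((u.length + k + 2) ^ c)) := by
  obtain ⟨B, hB, hl, hr⟩ := hG
  obtain ⟨P, hP⟩ := hr ![0] 1 (by decide)
  obtain ⟨c, hc⟩ : PolyBdd fun M => M * (1 + 1) + 1 + (M * (1 + 1) + 1) + (B M + ((M * 2 + 1) +
      ((M * 2 + 1) + (B M * (1 + 1) + 1)))) + 1 :=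
    (((((PolyBdd.id.mul (.const _)).add (.const 1)).add
      ((PolyBdd.id.mul (.const _)).add (.const 1))).add
      (hB.add (((PolyBdd.id.mul (.const 2)).add (.const 1)).add
      (((PolyBdd.id.mul (.const 2)).add (.const 1)).add
      ((hB.mul (.const _)).add (.const 1)))))).add (.const 1))
  -- After the output has been generated, the input and register `0` are cleared, since a halting
  -- configuration has no other non-empty stack than the output; the last loop also reverses the
  -- output.
  let W : Prog := .seq readTape (.seq P (.seq (.loop 0 fun _ => .skip) (.seq (forReg 0 .skip)
    (.loop 3 fun a => .push 1 a))))
  obtain ⟨b, hb⟩ := W.exists_below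
  refine ⟨W.machine (b + 1), c, fun u k => ?_⟩
  set ρ : Fin 1 → ℕ := ![k]
  have hρ : ∀ i, ρ i ≤ u.length + k := by
    intro i
    fin_cases i
    simp [ρ]
  set R : ℕ → ℕ := update (fun _ => 0) 0 k with hRdef
  have hR : env R ![0] = ρ := by
    funext i
    fin_cases i
    simp [ρ, R, env]
  have h1 := run_readTape u k
  have h2 := hP u [] R (u.length + k) (by omega)
    (fun i => (congrFun hR i).trans_le (hρ i))
    (fun j hj => by rw [hRdef, update_of_ne (by omega)])
  rw [hR, List.append_nil] at h2
  have h3 := run_loop_skip 0 (cfg (u.map some) [] (G u ρ).reverse R)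
  rw [update_cfg_zero] at h3
  have h3' := h3.mono (T' := (u.length + k) * 2 + 1) (by simp [cfg])
  have h4 : Run (forReg 0 .skip) (cfg [] [] (G u ρ).reverse R)
      (cfg [] [] (G u ρ).reverse fun _ => 0) ((u.length + k) * 2 + 1) :=
    run_clear (by simp [R]) (by
      funext l
      simp only [R, update_apply]
      split_ifs <;> rfl)
  have h6 := (run_writeOutput (G u ρ).reverse).mono (T' := B (u.length + k) * (1 + 1) + 1) (by
    rw [List.length_reverse]
    exact Nat.succ_le_succ (Nat.mul_le_mul_right _ (hl u ρ _ (by omega) hρ)))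
  rw [List.reverse_reverse] at h6
  obtain ⟨t, ht, he⟩ := h1.seq (h2.seq (h3'.seq (h4.seq h6)))
  have hin : cfg (tape (u, k)) [] [] (fun _ => 0) =
      (update (fun _ => []) 0 (tape (u, k)) : Store) := by
    funext l
    match l with
    | 0 => rfl
    | 1 => rfl
    | 2 => rfl
    | 3 => rfl
    | j + 4 => rfl
  rw [hin] at he
  exact Prog.outputsInTime (hb.mono (by omega)) (by omega) he
    ((Nat.succ_le_succ ht).trans (hc (u.length + k)))

theorem primrec_succ_pow (c : ℕ) : Primrec fun k : ℕ => (k + 1) ^ c := by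
  induction c with
  | zero => simpa using Primrec.const (α := ℕ) 1
  | succ c ih =>
    simp only [pow_succ]
    exact Primrec.nat_mul.comp ih Primrec.succ

/-- This separates a power of `|u| + k + 2` into a polynomial in `|u|` times a function of `k`, as
the definition of fpt-time demands. -/
theorem add_add_two_le (m k : ℕ) : m + k + 2 ≤ (m + 2) * (k + 1) := by nlinarith [Nat.zero_le (m * k)]

theorem FptReducible.of_gen {K L : Set (List Bool × ℕ)} (g : List Bool → ℕ → List Bool)
    (h : ℕ → ℕ) (hh : Computable h) {G : List Bool → (Fin 1 → ℕ) → List (Option Bool)}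
    (hG : Gen 1 G) (hGg : ∀ u k, G u ![k] = tape (g u k, h k))
    (hKL : ∀ u k, (u, k) ∈ K ↔ (g u k, h k) ∈ L) :
    FptReducible ⟨Bool, K⟩ ⟨Bool, L⟩ := by
  obtain ⟨M, c, hM⟩ := hG.exists_machine
  refine ⟨g, h, hh, ⟨M, (Polynomial.X + 2) ^ c, fun k => (k + 1) ^ c,
    (primrec_succ_pow c).to_comp, fun u k => ?_⟩, hKL⟩
  obtain ⟨e⟩ := hM u k
  rw [hGg] at e
  refine ⟨⟨e.toEvalsTo, e.steps_le_m.trans ?_⟩⟩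
  rw [Polynomial.eval_pow, Polynomial.eval_add, Polynomial.eval_X, Polynomial.eval_ofNat, ← mul_pow]
  exact Nat.pow_le_pow_left (add_add_two_le _ _) c

/-! ### Embedding of stack machines -/

section embed

variable {K K' : Type} {Γ : K → Type} {Γ' : K' → Type} {Λ Λ' σ σ' : Type}

/-- How a stack machine is embedded into another one: each stack is represented by a stack, and
each label and each state by a label and by a state. -/
structure MachineEmb (Γ : K → Type) (Γ' : K' → Type) (Λ Λ' σ σ' : Type) where
  /-- the stack that represents a stack -/
  stack : K → K'
  stack_inj : Injective stack
  /-- the representation of the symbols -/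
  sym : ∀ k, Γ k ≃ Γ' (stack k)
  /-- the representation of the labels -/
  lab : Λ → Λ'
  /-- the representation of the states -/
  state : σ → σ'
  /-- the state represented by a state -/
  unstate : σ' → σ
  unstate_state : ∀ v, unstate (state v) = v

namespace MachineEmb

variable (E : MachineEmb Γ Γ' Λ Λ' σ σ')

/-- The embedded statements, in which `fin` replaces the command to halt. -/
def stmt (fin : TM2.Stmt Γ' Λ' σ') : TM2.Stmt Γ Λ σ → TM2.Stmt Γ' Λ' σ'
  | .push k f q => .push (E.stack k) (fun v => E.sym k (f (E.unstate v))) (stmt fin q)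
  | .peek k f q => .peek (E.stack k)
      (fun v x => E.state (f (E.unstate v) (x.map (E.sym k).symm))) (stmt fin q)
  | .pop k f q => .pop (E.stack k)
      (fun v x => E.state (f (E.unstate v) (x.map (E.sym k).symm))) (stmt fin q)
  | .load f q => .load (fun v => E.state (f (E.unstate v))) (stmt fin q)
  | .branch f q q' => .branch (fun v => f (E.unstate v)) (stmt fin q) (stmt fin q')
  | .goto f => .goto fun v => E.lab (f (E.unstate v))
  | .halt => fin

/-- The stacks `S'` represent the stacks `S`, and all other stacks are empty. -/
def Rep (S : ∀ k, List (Γ k)) (S' : ∀ k, List (Γ' k)) : Prop :=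
  (∀ k, S' (E.stack k) = (S k).map (E.sym k)) ∧ ∀ k', (∀ k, k' ≠ E.stack k) → S' k' = []

variable {E}

theorem Rep.unique {S : ∀ k, List (Γ k)} {S' S'' : ∀ k, List (Γ' k)} (h : E.Rep S S')
    (h' : E.Rep S S'') : S' = S'' := by
  funext k'
  by_cases hk : ∃ k, k' = E.stack k
  · obtain ⟨k, rfl⟩ := hk
    rw [h.1, h'.1]
  · push Not at hk
    rw [h.2 k' hk, h'.2 k' hk]

variable [DecidableEq K] [DecidableEq K']

theorem Rep.update {S : ∀ k, List (Γ k)} {S' : ∀ k, List (Γ' k)} (h : E.Rep S S') (k : K)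
    (x : List (Γ k)) : E.Rep (update S k x) (update S' (E.stack k) (x.map (E.sym k))) := by
  constructor
  · intro l
    by_cases hl : l = k
    · subst hl
      simp
    · rw [update_of_ne hl, update_of_ne (fun e => hl (E.stack_inj e)), h.1]
  · intro k' hk'
    rw [update_of_ne (hk' k), h.2 k' hk']

/-- The statement `fin` is executed within the very step in which the original machine halts, so
handing over control costs no time. -/
theorem Rep.stepAux {fin : TM2.Stmt Γ' Λ' σ'} (q : TM2.Stmt Γ Λ σ) :
    ∀ {S : ∀ k, List (Γ k)} {S' : ∀ k, List (Γ' k)}, E.Rep S S' → ∀ v,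
      ∃ S'', E.Rep (TM2.stepAux q v S).stk S'' ∧
        TM2.stepAux (E.stmt fin q) (E.state v) S' =
          match (TM2.stepAux q v S).l with
          | some l => ⟨some (E.lab l), E.state (TM2.stepAux q v S).var, S''⟩
          | none => TM2.stepAux fin (E.state (TM2.stepAux q v S).var) S'' := by
  induction q with
  | push k f q ih =>
    intro S S' h v
    obtain ⟨S'', h1, h2⟩ := ih (h.update k (f v :: S k)) v
    refine ⟨S'', h1, ?_⟩
    rw [← TM2.stepAux] at h2
    rw [← h2]
    simp [stmt, TM2.stepAux, E.unstate_state, h.1]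
  | peek k f q ih =>
    intro S S' h v
    obtain ⟨S'', h1, h2⟩ := ih h (f v (S k).head?)
    refine ⟨S'', h1, ?_⟩
    rw [← TM2.stepAux] at h2
    rw [← h2]
    simp [stmt, TM2.stepAux, E.unstate_state, h.1, Function.comp_def]
  | pop k f q ih =>
    intro S S' h v
    obtain ⟨S'', h1, h2⟩ := ih (h.update k (S k).tail) (f v (S k).head?)
    refine ⟨S'', h1, ?_⟩
    rw [← TM2.stepAux] at h2
    rw [← h2]
    simp [stmt, TM2.stepAux, E.unstate_state, h.1, Function.comp_def]
  | load f q ih =>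
    intro S S' h v
    obtain ⟨S'', h1, h2⟩ := ih h (f v)
    refine ⟨S'', h1, ?_⟩
    rw [← TM2.stepAux] at h2
    rw [← h2]
    simp [stmt, TM2.stepAux, E.unstate_state]
  | branch f q q' ih ih' =>
    intro S S' h v
    rcases hf : f v with _ | _
    · obtain ⟨S'', h1, h2⟩ := ih' h v
      refine ⟨S'', by simpa [TM2.stepAux, hf] using h1, ?_⟩
      simpa [stmt, TM2.stepAux, E.unstate_state, hf] using h2
    · obtain ⟨S'', h1, h2⟩ := ih h v
      refine ⟨S'', by simpa [TM2.stepAux, hf] using h1, ?_⟩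
      simpa [stmt, TM2.stepAux, E.unstate_state, hf] using h2
  | goto f =>
    intro S S' h v
    exact ⟨S', h, by simp [stmt, TM2.stepAux, E.unstate_state]⟩
  | halt =>
    intro S S' h v
    exact ⟨S', h, by simp [stmt, TM2.stepAux]⟩

theorem iterate_bind_none {α : Type} (f : α → Option α) (n : ℕ) : (flip bind f)^[n] none = none := by
  induction n with
  | zero => rfl
  | succ n ih => rwa [iterate_succ_apply]

/-- An embedded machine simulates a halting computation up to its last step. -/
theorem Rep.iterate {M : Λ → TM2.Stmt Γ Λ σ} {M' : Λ' → TM2.Stmt Γ' Λ' σ'}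
    {fin : TM2.Stmt Γ' Λ' σ'} (hM : ∀ l, M' (E.lab l) = E.stmt fin (M l)) {v' : σ}
    {T : ∀ k, List (Γ k)} (n : ℕ) :
    ∀ {S : ∀ k, List (Γ k)} {S' : ∀ k, List (Γ' k)}, E.Rep S S' → ∀ l v,
      (flip bind (TM2.step M))^[n] (some ⟨some l, v, S⟩) = some ⟨none, v', T⟩ →
      ∃ T', E.Rep T T' ∧ (flip bind (TM2.step M'))^[n] (some ⟨some (E.lab l), E.state v, S'⟩) =
        some (TM2.stepAux fin (E.state v') T') := by
  induction n with
  | zero =>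
    intro S S' h l v e
    simp at e
  | succ n ih =>
    intro S S' h l v e
    rw [iterate_succ_apply] at e ⊢
    obtain ⟨S'', h1, h2⟩ := h.stepAux (fin := fin) (M l) v
    have e1 : flip bind (TM2.step M) (some ⟨some l, v, S⟩) = some (TM2.stepAux (M l) v S) := rfl
    have e2 : flip bind (TM2.step M') (some ⟨some (E.lab l), E.state v, S'⟩) =
        some (TM2.stepAux (M' (E.lab l)) (E.state v) S') := rfl
    rw [e1] at e
    rw [e2, hM, h2]
    generalize TM2.stepAux (M l) v S = c at e h1
    obtain ⟨_ | l', w, U⟩ := c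
    -- A halted configuration has no successor, so no steps can remain.
    · rcases n with _ | n
      · simp only [iterate_zero, id_eq, Option.some.injEq, TM2.Cfg.mk.injEq, true_and] at e
        obtain ⟨rfl, rfl⟩ := e
        exact ⟨S'', h1, rfl⟩
      · rw [iterate_succ_apply] at e
        have : flip bind (TM2.step M) (some ⟨none, w, U⟩) = none := rfl
        rw [this, iterate_bind_none] at e
        exact absurd e (by simp)
    · exact ih h1 l' w e

end MachineEmb

/-! ### The growth of the stacks -/

/-- The number of push commands in a statement. -/
def pushCount : TM2.Stmt Γ Λ σ → ℕ
  | .push _ _ q => pushCount q + 1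
  | .peek _ _ q => pushCount q
  | .pop _ _ q => pushCount q
  | .load _ q => pushCount q
  | .branch _ q q' => pushCount q + pushCount q'
  | .goto _ => 0
  | .halt => 0

variable [DecidableEq K]

theorem length_stepAux_le (k : K) (q : TM2.Stmt Γ Λ σ) :
    ∀ v (S : ∀ k, List (Γ k)),
      ((TM2.stepAux q v S).stk k).length ≤ (S k).length + pushCount q := by
  induction q with
  | push l f q ih =>
    intro v S
    refine (ih v _).trans ?_
    by_cases h : k = l
    · subst h
      simp only [update_self, List.length_cons, pushCount]
      omega
    · rw [update_of_ne h, pushCount]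
      omega
  | peek l f q ih => exact fun v S => ih _ _
  | pop l f q ih =>
    intro v S
    refine (ih _ _).trans (Nat.add_le_add_right ?_ _)
    by_cases h : k = l
    · subst h
      simp
    · rw [update_of_ne h]
  | load f q ih => exact fun v S => ih _ _
  | branch f q q' ih ih' =>
    intro v S
    have := ih v S
    have := ih' v S
    rw [TM2.stepAux, pushCount]
    rcases f v with _ | _ <;> simp only [cond_true, cond_false] <;> omega
  | goto f => exact fun v S => le_rfl
  | halt => exact fun v S => le_rfl

/-- One step adds to a stack at most as many symbols as the executed statement has push commands;
summing over all labels gives a constant for the machine. -/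
theorem length_iterate_le [Fintype Λ] {M : Λ → TM2.Stmt Γ Λ σ} (k : K) (n : ℕ) :
    ∀ c c' : TM2.Cfg Γ Λ σ, (flip bind (TM2.step M))^[n] (some c) = some c' →
      (c'.stk k).length ≤ (c.stk k).length + n * ∑ l, pushCount (M l) := by
  induction n with
  | zero =>
    intro c c' e
    simp only [iterate_zero, id_eq, Option.some.injEq] at e
    simp [e]
  | succ n ih =>
    intro c c' e
    rw [iterate_succ_apply] at e
    obtain ⟨_ | l, v, S⟩ := c
    · have : flip bind (TM2.step M) (some ⟨none, v, S⟩) = none := rfl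
      rw [this, MachineEmb.iterate_bind_none] at e
      exact absurd e (by simp)
    · have e1 : flip bind (TM2.step M) (some ⟨some l, v, S⟩) = some (TM2.stepAux (M l) v S) := rfl
      rw [e1] at e
      have h1 := ih _ _ e
      have h2 := length_stepAux_le k (M l) v S
      have h3 : pushCount (M l) ≤ ∑ l, pushCount (M l) :=
        Finset.single_le_sum (f := fun l => pushCount (M l)) (fun _ _ => Nat.zero_le _)
          (Finset.mem_univ l)
      rw [Nat.succ_mul]
      dsimp only
      omega

end embed

/-! ### Composition of machines -/

section contents

variable (tm : FinTM2)

theorem initList_self (s : List (tm.Γ tm.k₀)) : (initList tm s).stk tm.k₀ = s := by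
  simp [initList]

theorem initList_of_ne (s : List (tm.Γ tm.k₀)) {k : tm.K} (h : k ≠ tm.k₀) :
    (initList tm s).stk k = [] := by
  simp [initList, h]

theorem haltList_self (s : List (tm.Γ tm.k₁)) : (haltList tm s).stk tm.k₁ = s := by
  simp [haltList]

theorem haltList_of_ne (s : List (tm.Γ tm.k₁)) {k : tm.K} (h : k ≠ tm.k₁) :
    (haltList tm s).stk k = [] := by
  simp [haltList, h]

end contents

namespace Compose

variable {A B C : Type} (M : TM2ComputableAux A B) (N : TM2ComputableAux B C)

/-- The alphabets of the stacks of the composed machine. -/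
abbrev Stk : M.tm.K ⊕ N.tm.K → Type := Sum.elim M.tm.Γ N.tm.Γ

/-- The representation of the stacks of the second machine. Its input stack is represented by the
output stack of the first machine. -/
def shared (k : N.tm.K) : Σ k' : M.tm.K ⊕ N.tm.K, N.tm.Γ k ≃ Stk M N k' :=
  if h : k = N.tm.k₀ then
    ⟨.inl M.tm.k₁, h ▸ N.inputAlphabet.trans M.outputAlphabet.symm⟩
  else ⟨.inr k, Equiv.refl _⟩

theorem shared_input : shared M N N.tm.k₀ =
    ⟨.inl M.tm.k₁, N.inputAlphabet.trans M.outputAlphabet.symm⟩ := dif_pos rfl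

theorem shared_of_ne {k : N.tm.K} (h : k ≠ N.tm.k₀) : shared M N k = ⟨.inr k, Equiv.refl _⟩ :=
  dif_neg h

/-- The embedding of the first machine. -/
def fstEmb : MachineEmb M.tm.Γ (Stk M N) M.tm.Λ (M.tm.Λ ⊕ N.tm.Λ) M.tm.σ (M.tm.σ ⊕ N.tm.σ) where
  stack := .inl
  stack_inj := Sum.inl_injective
  sym _ := Equiv.refl _
  lab := .inl
  state := .inl
  unstate := Sum.elim id fun _ => M.tm.initialState
  unstate_state _ := rfl

/-- The embedding of the second machine. -/
def sndEmb : MachineEmb N.tm.Γ (Stk M N) N.tm.Λ (M.tm.Λ ⊕ N.tm.Λ) N.tm.σ (M.tm.σ ⊕ N.tm.σ) where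
  stack k := (shared M N k).1
  stack_inj k l h := by
    dsimp only at h
    by_cases hk : k = N.tm.k₀ <;> by_cases hl : l = N.tm.k₀
    · rw [hk, hl]
    · rw [hk, shared_input, shared_of_ne M N hl] at h
      simp at h
    · rw [hl, shared_input, shared_of_ne M N hk] at h
      simp at h
    · rw [shared_of_ne M N hk, shared_of_ne M N hl] at h
      simpa using h
  sym k := (shared M N k).2
  lab := .inr
  state := .inr
  unstate := Sum.elim (fun _ => N.tm.initialState) id
  unstate_state _ := rfl

/-- The command that starts the second machine. -/
def handOver : TM2.Stmt (Stk M N) (M.tm.Λ ⊕ N.tm.Λ) (M.tm.σ ⊕ N.tm.σ) :=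
  .load (fun _ => .inr N.tm.initialState) (.goto fun _ => .inr N.tm.main)

/-- The command that stops the composed machine. -/
def finish : TM2.Stmt (Stk M N) (M.tm.Λ ⊕ N.tm.Λ) (M.tm.σ ⊕ N.tm.σ) :=
  .load (fun _ => .inl M.tm.initialState) .halt

/-- The composition of two machines. -/
def machine : TM2ComputableAux A C where
  tm :=
    { K := M.tm.K ⊕ N.tm.K
      kDecidableEq := inferInstanceAs (DecidableEq (M.tm.K ⊕ N.tm.K))
      kFin :=
        haveI := M.tm.kFin
        haveI := N.tm.kFin
        inferInstanceAs (Fintype (M.tm.K ⊕ N.tm.K))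
      k₀ := .inl M.tm.k₀
      k₁ := (shared M N N.tm.k₁).1
      Γ := Stk M N
      Λ := M.tm.Λ ⊕ N.tm.Λ
      main := .inl M.tm.main
      ΛFin :=
        haveI := M.tm.ΛFin
        haveI := N.tm.ΛFin
        inferInstanceAs (Fintype (M.tm.Λ ⊕ N.tm.Λ))
      σ := M.tm.σ ⊕ N.tm.σ
      initialState := .inl M.tm.initialState
      σFin :=
        haveI := M.tm.σFin
        haveI := N.tm.σFin
        inferInstanceAs (Fintype (M.tm.σ ⊕ N.tm.σ))
      Γk₀Fin := M.tm.Γk₀Fin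
      m := Sum.elim (fun l => (fstEmb M N).stmt (handOver M N) (M.tm.m l))
        (fun l => (sndEmb M N).stmt (finish M N) (N.tm.m l)) }
  inputAlphabet := M.inputAlphabet
  outputAlphabet := (shared M N N.tm.k₁).2.symm.trans N.outputAlphabet

theorem rep_init (x : List A) : (fstEmb M N).Rep
    (initList M.tm (x.map M.inputAlphabet.symm)).stk
    (initList (machine M N).tm (x.map (machine M N).inputAlphabet.symm)).stk := by
  constructor
  · intro k
    by_cases h : k = M.tm.k₀
    · subst h
      rw [initList_self]
      refine (initList_self (machine M N).tm _).trans ?_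
      exact (List.map_id _).symm
    · rw [initList_of_ne _ _ h]
      exact initList_of_ne (machine M N).tm _ fun e => h (Sum.inl_injective e)
  · intro k hk
    exact initList_of_ne (machine M N).tm _ (hk M.tm.k₀)

/-- The first machine halts with only its output stack non-empty, and this stack represents the
input stack of the second one. Translating symbols through `B` makes the contents agree. -/
theorem rep_handOver (y : List B) {S : ∀ k, List (Stk M N k)}
    (h : (fstEmb M N).Rep (haltList M.tm (y.map M.outputAlphabet.symm)).stk S) :
    (sndEmb M N).Rep (initList N.tm (y.map N.inputAlphabet.symm)).stk S := by
  have hr : ∀ k, S (.inr k) = [] := fun k => h.2 _ fun l e => Sum.inr_ne_inl e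
  have hl : ∀ k, k ≠ M.tm.k₁ → S (.inl k) = [] := by
    intro k hk
    refine (h.1 k).trans ?_
    rw [haltList_of_ne _ _ hk]
    rfl
  have h1 : S (.inl M.tm.k₁) = y.map M.outputAlphabet.symm := by
    refine (h.1 _).trans ?_
    rw [haltList_self]
    exact List.map_id _
  constructor
  · intro k
    by_cases hk : k = N.tm.k₀
    · subst hk
      rw [initList_self]
      change S (shared M N N.tm.k₀).1 = (y.map N.inputAlphabet.symm).map (shared M N N.tm.k₀).2
      rw [shared_input, List.map_map]
      refine h1.trans (List.map_congr_left fun a _ => ?_)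
      change M.outputAlphabet.symm a = M.outputAlphabet.symm (N.inputAlphabet _)
      rw [Equiv.apply_symm_apply]
    · rw [initList_of_ne _ _ hk]
      change S (shared M N k).1 = []
      rw [shared_of_ne M N hk]
      exact hr k
  · rintro (k | k) hk
    · refine hl k ?_
      rintro rfl
      refine hk N.tm.k₀ ?_
      change _ = (shared M N N.tm.k₀).1
      rw [shared_input]
    · exact hr k

theorem rep_halt (z : List C) : (sndEmb M N).Rep
    (haltList N.tm (z.map N.outputAlphabet.symm)).stk
    (haltList (machine M N).tm (z.map (machine M N).outputAlphabet.symm)).stk := by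
  constructor
  · intro k
    by_cases h : k = N.tm.k₁
    · subst h
      rw [haltList_self]
      refine (haltList_self (machine M N).tm _).trans ?_
      rw [List.map_map]
      exact List.map_congr_left fun a _ => rfl
    · rw [haltList_of_ne _ _ h]
      exact haltList_of_ne (machine M N).tm _ fun e => h ((sndEmb M N).stack_inj e)
  · intro k hk
    exact haltList_of_ne (machine M N).tm _ (hk N.tm.k₁)

/-- The hand-over and the final reset of the state replace the halting commands of the two machines,
so the running times just add up. -/
theorem outputsInTime {x : List A} {y : List B} {z : List C} {s t : ℕ}
    (h : Nonempty (TM2OutputsInTime M.tm (x.map M.inputAlphabet.symm)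
      (some (y.map M.outputAlphabet.symm)) s))
    (h' : Nonempty (TM2OutputsInTime N.tm (y.map N.inputAlphabet.symm)
      (some (z.map N.outputAlphabet.symm)) t)) :
    Nonempty (TM2OutputsInTime (machine M N).tm (x.map (machine M N).inputAlphabet.symm)
      (some (z.map (machine M N).outputAlphabet.symm)) (s + t)) := by
  obtain ⟨⟨m, hm⟩, hms⟩ := h
  obtain ⟨⟨n, hn⟩, hnt⟩ := h'
  obtain ⟨S, hS, e⟩ := (rep_init M N x).iterate (M' := (machine M N).tm.m) (fin := handOver M N)
    (fun _ => rfl) m _ _ hm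
  obtain ⟨T, hT, e'⟩ := (rep_handOver M N y hS).iterate (M' := (machine M N).tm.m)
    (fin := finish M N) (fun _ => rfl) n _ _ hn
  rw [hT.unique (rep_halt M N z)] at e'
  exact ⟨⟨⟨m + n, iterate_bind_add e e'⟩, add_le_add hms hnt⟩⟩

end Compose

/-! ### Transitivity of fpt-reductions. -/

theorem length_le_of_outputs {A B : Type} (M : TM2ComputableAux A B) :
    ∃ c, ∀ (x : List A) (y : List B) (t : ℕ),
      Nonempty (TM2OutputsInTime M.tm (x.map M.inputAlphabet.symm)
        (some (y.map M.outputAlphabet.symm)) t) → y.length ≤ x.length + t * c := by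
  have := M.tm.ΛFin
  refine ⟨∑ l, pushCount (M.tm.m l), fun x y t ⟨⟨⟨n, hn⟩, hnt⟩⟩ => ?_⟩
  have h := length_iterate_le (M := M.tm.m) M.tm.k₁ n _ _ hn
  rw [haltList_self, List.length_map] at h
  have h0 : ((initList M.tm (x.map M.inputAlphabet.symm)).stk M.tm.k₁).length ≤ x.length := by
    -- Input and output may share a stack, which then starts with the input; this is where the
    -- summand `x.length` comes from.
    by_cases hk : M.tm.k₁ = M.tm.k₀
    · have : ∀ k, k = M.tm.k₀ →
          ((initList M.tm (x.map M.inputAlphabet.symm)).stk k).length = x.length := by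
        rintro _ rfl
        rw [initList_self, List.length_map]
      exact (this _ hk).le
    · rw [initList_of_ne _ _ hk]
      exact Nat.zero_le _
  exact h.trans (add_le_add h0 (Nat.mul_le_mul_right _ hnt))

theorem polyBdd_eval (p : Polynomial ℕ) : PolyBdd fun n => p.eval n := by
  induction p using Polynomial.induction_on' with
  | add p q hp hq => simpa only [Polynomial.eval_add] using hp.add hq
  | monomial n a =>
    simp only [Polynomial.eval_monomial]
    exact (PolyBdd.const a).mul (PolyBdd.id.pow n)

theorem length_tape {Γ : Type} (x : List Γ × ℕ) : (tape x).length = x.1.length + x.2 := by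
  simp [tape, add_comm]

theorem computable_pow {f : ℕ → ℕ} (hf : Computable f) (c : ℕ) : Computable fun k => f k ^ c := by
  induction c with
  | zero => simpa using Computable.const (α := ℕ) 1
  | succ c ih =>
    simp only [pow_succ]
    exact Primrec.nat_mul.to_comp.comp ih hf

/-- The intermediate word has length at most `|u| + k + p(|u|) f(k) c`, which is a polynomial in
`|u|` times a function of `k`; a polynomial of it is again of this form. Since the new parameter `h
k` depends on `k` only and computably so, the factor `f' (h k)` is admissible. -/
theorem FptReducible.trans {K L J : ParamProblem} (hKL : FptReducible K L)
    (hLJ : FptReducible L J) : FptReducible K J := by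
  obtain ⟨g, h, hh, ⟨M, p, f, hf, hM⟩, hr⟩ := hKL
  obtain ⟨g', h', hh', ⟨M', p', f', hf', hM'⟩, hr'⟩ := hLJ
  obtain ⟨a, ha⟩ := polyBdd_eval p
  obtain ⟨b, hb⟩ := polyBdd_eval p'
  obtain ⟨c, hc⟩ := length_le_of_outputs M
  refine ⟨fun u k => g' (g u k) (h k), fun k => h' (h k), hh'.comp hh,
    ⟨Compose.machine M M', (Polynomial.X + 2) ^ (a + (a + 1) * b),
      fun k => f k + ((k + 1) * (c * f k + 1)) ^ b * f' (h k), ?_, fun u k => ?_⟩,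
    fun u k => (hr u k).trans (hr' _ _)⟩
  · refine Primrec.nat_add.to_comp.comp hf (Primrec.nat_mul.to_comp.comp (computable_pow
      (Primrec.nat_mul.to_comp.comp Primrec.succ.to_comp (Primrec.succ.to_comp.comp
        (Primrec.nat_mul.to_comp.comp (Computable.const c) hf))) b) (hf'.comp hh))
  · obtain ⟨e⟩ := Compose.outputsInTime M M' (hM u k) (hM' (g u k) (h k))
    refine ⟨⟨e.toEvalsTo, e.steps_le_m.trans ?_⟩⟩
    rw [Polynomial.eval_pow, Polynomial.eval_add, Polynomial.eval_X, Polynomial.eval_ofNat, mul_add]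
    set n := u.length
    have hn : 1 ≤ n + 2 := by omega
    have h1 : p.eval n * f k ≤ (n + 2) ^ a * f k := Nat.mul_le_mul_right _ (ha n)
    have hlen := hc _ _ _ (hM u k)
    rw [length_tape, length_tape] at hlen
    have h2 : (g u k).length + 2 ≤ (n + 2) ^ (a + 1) * ((k + 1) * (c * f k + 1)) := by
      have h3 := add_add_two_le n k
      have h4 : n + 2 ≤ (n + 2) ^ (a + 1) := Nat.le_self_pow (by omega) _
      have h5 : (n + 2) ^ a ≤ (n + 2) ^ (a + 1) := Nat.pow_le_pow_right hn (by omega)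
      calc (g u k).length + 2 ≤ (n + k + 2) + p.eval n * f k * c := by
            change (g u k).length + h k ≤ n + k + p.eval n * f k * c at hlen
            omega
        _ ≤ (n + 2) ^ (a + 1) * (k + 1) + (n + 2) ^ (a + 1) * f k * c :=
            add_le_add (h3.trans (Nat.mul_le_mul_right _ h4))
              (Nat.mul_le_mul_right _ (h1.trans (Nat.mul_le_mul_right _ h5)))
        -- The added cross term completes the product `(k + 1) * (c * f k + 1)`.
        _ ≤ (n + 2) ^ (a + 1) * (k + 1) + (n + 2) ^ (a + 1) * f k * c +
            (n + 2) ^ (a + 1) * (k * (c * f k)) := Nat.le_add_right _ _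
        _ = _ := by ring
    refine add_le_add (h1.trans (Nat.mul_le_mul_right _ (Nat.pow_le_pow_right hn (by omega)))) ?_
    calc p'.eval (g u k).length * f' (h k)
        ≤ ((n + 2) ^ (a + 1) * ((k + 1) * (c * f k + 1))) ^ b * f' (h k) :=
          Nat.mul_le_mul_right _ ((hb _).trans (Nat.pow_le_pow_left h2 b))
      _ = (n + 2) ^ ((a + 1) * b) * (((k + 1) * (c * f k + 1)) ^ b * f' (h k)) := by
          rw [mul_pow, ← pow_mul, mul_assoc]
      _ ≤ _ := Nat.mul_le_mul_right _ (Nat.pow_le_pow_right hn (by omega))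

/-! ### Closure properties of polynomial-time computation -/

namespace Cmp

variable {d : ℕ} {f g : List Bool → (Fin d → ℕ) → ℕ}

theorem len : Cmp d fun u _ => u.length := by
  refine ⟨fun M => M * (2 + 1) + 1 + (M * (1 + 1) + 1), ?_, ?_, ?_⟩
  · exact ((PolyBdd.id.mul (.const _)).add (.const 1)).add
      ((PolyBdd.id.mul (.const _)).add (.const 1))
  · intro u ρ M hu _
    dsimp only
    omega
  · intro ν t hν
    refine ⟨.seq (.loop 0 fun a => .seq (.push 2 a) (inc t)) (.loop 2 fun a => .push 0 a),
      fun u o R M hu _ hz => ?_⟩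
    have h0 := hz t le_rfl
    have h := Run.loop (k := 0) (T := 2) (Q := fun a => .seq (.push 2 a) (inc t)) (u.map some)
      (fun m => cfg ((u.map some).drop m) ((u.map some).take m).reverse o (update R t m))
      (fun m _ => rfl)
      (fun m hm => by
        rw [update_cfg_zero]
        have := Run.push 2 (u.map some)[m] (cfg ((u.map some).drop (m + 1))
          ((u.map some).take m).reverse o (update R t m))
        rw [update_cfg_two] at this
        refine Run.seq (T := 1) (T' := 1) this ?_
        rw [List.take_succ_eq_append_getElem hm, List.reverse_append]
        exact run_inc t (by simp))
    have h' := Run.loop (k := 2) (T := 1) (Q := fun a => .push 0 a) (u.map some).reverse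
      (fun m => cfg ((u.map some).reverse.take m).reverse ((u.map some).reverse.drop m) o
        (update R t u.length))
      (fun m _ => rfl)
      (fun m hm => by
        rw [update_cfg_two]
        have := Run.push 0 ((u.map some).reverse)[m]
          (cfg (((u.map some).reverse).take m).reverse ((u.map some).reverse.drop (m + 1)) o
            (update R t u.length))
        rw [update_cfg_zero] at this
        rw [List.take_succ_eq_append_getElem hm, List.reverse_append]
        exact this)
    simp only [List.drop_zero, List.take_zero, List.reverse_nil, List.take_length,
      List.drop_length, List.reverse_reverse] at h h'
    simp only [List.length_reverse, List.length_map] at h h'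
    rw [update_eq_self_iff.2 h0.symm] at h
    exact (h.mono (Nat.succ_le_succ (Nat.mul_le_mul_right _ hu))).seq
      (h'.mono (Nat.succ_le_succ (Nat.mul_le_mul_right _ hu)))

theorem mul (hf : Cmp d f) (hg : Cmp d g) : Cmp d fun u ρ => f u ρ * g u ρ := by
  simpa using Cmp.sum (g := fun u ρ _ => g u ρ) hf hg.weaken

end Cmp

open Classical in
/-- Predicates that are decided in polynomial time. -/
def CmpPred (d : ℕ) (p : List Bool → (Fin d → ℕ) → Prop) : Prop :=
  Cmp d fun u ρ => if p u ρ then 1 else 0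

namespace CmpPred

variable {d : ℕ} {f g : List Bool → (Fin d → ℕ) → ℕ} {p q : List Bool → (Fin d → ℕ) → Prop}

theorem not (hp : CmpPred d p) : CmpPred d fun u ρ => ¬ p u ρ := by
  have h := (Cmp.const 1).sub hp
  unfold CmpPred
  convert h using 3 with u ρ
  by_cases h : p u ρ <;> simp [h]

theorem and (hp : CmpPred d p) (hq : CmpPred d q) : CmpPred d fun u ρ => p u ρ ∧ q u ρ := by
  have h := Cmp.mul hp hq
  unfold CmpPred
  convert h using 3 with u ρ
  by_cases h : p u ρ <;> by_cases h' : q u ρ <;> simp [h, h']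

theorem lt (hf : Cmp d f) (hg : Cmp d g) : CmpPred d fun u ρ => f u ρ < g u ρ := by
  -- Under truncated subtraction `1 - (1 - x)` is the indicator of `x > 0`.
  have h := (Cmp.const 1).sub ((Cmp.const 1).sub (hg.sub hf))
  unfold CmpPred
  convert h using 3 with u ρ
  split_ifs <;> omega

theorem le (hf : Cmp d f) (hg : Cmp d g) : CmpPred d fun u ρ => f u ρ ≤ g u ρ := by
  simpa only [not_lt] using (lt hg hf).not

theorem eq (hf : Cmp d f) (hg : Cmp d g) : CmpPred d fun u ρ => f u ρ = g u ρ := by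
  simpa only [le_antisymm_iff] using (le hf hg).and (le hg hf)

/-- The number of counterexamples is a bounded sum, and it is compared with zero. -/
theorem forall_lt {p : List Bool → (Fin d → ℕ) → ℕ → Prop} (hf : Cmp d f)
    (hp : CmpPred (d + 1) fun u ρ => p u (fun i => ρ i.castSucc) (ρ (Fin.last d))) :
    CmpPred d fun u ρ => ∀ i < f u ρ, p u ρ i := by
  classical
  have h := eq (Cmp.sum (g := fun u ρ i => 1 - if p u ρ i then 1 else 0) hf
    ((Cmp.const 1).sub hp)) (Cmp.const 0)
  unfold CmpPred at h ⊢
  convert h using 5 with u ρ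
  simp only [Finset.sum_eq_zero_iff, Finset.mem_range]
  refine forall₂_congr fun i _ => ?_
  by_cases hi : p u ρ i <;> simp [hi]

end CmpPred

theorem Cmp.ite {d : ℕ} {f g : List Bool → (Fin d → ℕ) → ℕ} {p : List Bool → (Fin d → ℕ) → Prop}
    [∀ u ρ, Decidable (p u ρ)] (hp : CmpPred d p) (hf : Cmp d f) (hg : Cmp d g) :
    Cmp d fun u ρ => if p u ρ then f u ρ else g u ρ := by
  have h := (Cmp.mul hp hf).add (Cmp.mul hp.not hg)
  convert h using 3 with u ρ
  by_cases h : p u ρ <;> simp [h]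

/-- Each branch is repeated as often as the indicator of its condition says, that is, once or never.
The extra variable of the branches is the dummy index of this loop. -/
theorem Gen.ite {d : ℕ} {G H : List Bool → (Fin d → ℕ) → List (Option Bool)}
    {p : List Bool → (Fin d → ℕ) → Prop} [∀ u ρ, Decidable (p u ρ)] (hp : CmpPred d p)
    (hG : Gen (d + 1) fun u ρ => G u fun i => ρ i.castSucc)
    (hH : Gen (d + 1) fun u ρ => H u fun i => ρ i.castSucc) :
    Gen d fun u ρ => if p u ρ then G u ρ else H u ρ := by
  have h := (Gen.flatMap (G := fun u ρ _ => G u ρ) hp hG).append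
    (Gen.flatMap (G := fun u ρ _ => H u ρ) hp.not hH)
  convert h using 3 with u ρ
  by_cases h : p u ρ <;> simp [h]

theorem Gen.replicate {d : ℕ} {f : List Bool → (Fin d → ℕ) → ℕ} (hf : Cmp d f) (a : Option Bool) :
    Gen d fun u ρ => List.replicate (f u ρ) a := by
  have h := Gen.flatMap (G := fun _ _ _ => [a]) hf (Gen.singleton a)
  convert h using 3 with u ρ
  generalize f u ρ = n
  induction n with
  | zero => rfl
  | succ n ih => rw [List.range_succ, List.flatMap_append, ← ih, List.replicate_succ']; rfl

/-- Sequences of numbers whose code words are produced in polynomial time. -/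
def GenList (d : ℕ) (L : List Bool → (Fin d → ℕ) → List ℕ) : Prop :=
  Gen d fun u ρ => (word (L u ρ)).map some

theorem word_append (l m : List ℕ) : word (l ++ m) = word l ++ word m := List.flatMap_append

theorem word_cons (n : ℕ) (l : List ℕ) : word (n :: l) = List.replicate n true ++ false :: word l := by
  simp [word]

namespace GenList

variable {d : ℕ} {L L' : List Bool → (Fin d → ℕ) → List ℕ}

theorem nil : GenList d fun _ _ => [] := Gen.nil

theorem append (hL : GenList d L) (hL' : GenList d L') : GenList d fun u ρ => L u ρ ++ L' u ρ := by
  unfold GenList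
  simpa only [word_append, List.map_append] using Gen.append hL hL'

theorem cons {f : List Bool → (Fin d → ℕ) → ℕ} (hf : Cmp d f) (hL : GenList d L) :
    GenList d fun u ρ => f u ρ :: L u ρ := by
  unfold GenList
  simpa only [word_cons, List.map_append, List.map_cons, List.map_replicate, List.append_assoc,
    List.cons_append, List.nil_append] using
    ((Gen.replicate hf (some true)).append (Gen.singleton (some false))).append hL

theorem flatMap {f : List Bool → (Fin d → ℕ) → ℕ} {L : List Bool → (Fin d → ℕ) → ℕ → List ℕ}
    (hf : Cmp d f)
    (hL : GenList (d + 1) fun u ρ => L u (fun i => ρ i.castSucc) (ρ (Fin.last d))) :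
    GenList d fun u ρ => (List.range (f u ρ)).flatMap (L u ρ) := by
  have h := Gen.flatMap (G := fun u ρ i => (word (L u ρ i)).map some) hf hL
  unfold GenList
  convert h using 3 with u ρ
  simp only [word, List.map_flatMap, List.flatMap_assoc]

end GenList

/-! ### Reading sequences of numbers -/

/-- The number of zeros among the first `p` bits. -/
def zeros (u : List Bool) (p : ℕ) : ℕ := ∑ q ∈ Finset.range p, (1 - bitAt u q)

/-- The length of the sequence encoded by a word. -/
def numCount (u : List Bool) : ℕ := zeros u u.length

/-- The `i`-th entry of the sequence encoded by a word. -/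
def numAt (u : List Bool) (i : ℕ) : ℕ :=
  ∑ p ∈ Finset.range u.length, if bitAt u p = 1 ∧ zeros u p = i then 1 else 0

/-- The last bit of the word is not `1`. -/
def Closed (u : List Bool) : Prop := bitAt u (u.length - 1) = 0

section

variable {d : ℕ} {f : List Bool → (Fin d → ℕ) → ℕ}

theorem Cmp.zeros (hf : Cmp d f) : Cmp d fun u ρ => PFact.zeros u (f u ρ) :=
  Cmp.sum (g := fun u _ q => 1 - bitAt u q) hf ((Cmp.const 1).sub (Cmp.var (Fin.last d)).bit)

theorem Cmp.numCount : Cmp d fun u _ => PFact.numCount u := Cmp.zeros Cmp.len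

theorem Cmp.numAt (hf : Cmp d f) : Cmp d fun u ρ => PFact.numAt u (f u ρ) :=
  Cmp.sum (f := fun u _ => u.length)
    (g := fun u ρ p => if bitAt u p = 1 ∧ PFact.zeros u p = f u ρ then 1 else 0) Cmp.len
    (Cmp.ite (((CmpPred.eq (Cmp.var (Fin.last d)).bit (Cmp.const 1))).and
      (CmpPred.eq (Cmp.zeros (Cmp.var (Fin.last d))) hf.weaken)) (Cmp.const 1) (Cmp.const 0))

theorem CmpPred.closed : CmpPred d fun u _ => Closed u :=
  CmpPred.eq (Cmp.len.sub (Cmp.const 1)).bit (Cmp.const 0)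

end

theorem bitAt_cons_zero (b : Bool) (u : List Bool) : bitAt (b :: u) 0 = b.toNat := rfl

theorem bitAt_cons_succ (b : Bool) (u : List Bool) (p : ℕ) : bitAt (b :: u) (p + 1) = bitAt u p := rfl

theorem zeros_cons_succ (b : Bool) (u : List Bool) (p : ℕ) :
    zeros (b :: u) (p + 1) = zeros u p + (1 - b.toNat) :=
  Finset.sum_range_succ' _ _

theorem numCount_cons (b : Bool) (u : List Bool) :
    numCount (b :: u) = numCount u + (1 - b.toNat) := zeros_cons_succ b u u.length

theorem numAt_true (u : List Bool) (i : ℕ) :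
    numAt (true :: u) i = numAt u i + if i = 0 then 1 else 0 := by
  rw [numAt, List.length_cons, Finset.sum_range_succ']
  refine congrArg₂ _ (Finset.sum_congr rfl fun p _ => ?_) ?_
  · simp [bitAt_cons_succ, zeros_cons_succ]
  · simp [bitAt_cons_zero, zeros, eq_comm]

theorem numAt_false_zero (u : List Bool) : numAt (false :: u) 0 = 0 := by
  rw [numAt, List.length_cons, Finset.sum_range_succ']
  simp [bitAt_cons_zero, zeros_cons_succ]

theorem numAt_false_succ (u : List Bool) (i : ℕ) : numAt (false :: u) (i + 1) = numAt u i := by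
  rw [numAt, List.length_cons, Finset.sum_range_succ']
  simp [bitAt_cons_zero, bitAt_cons_succ, zeros_cons_succ, numAt]

theorem numCount_word (l : List ℕ) : numCount (word l) = l.length := by
  induction l with
  | nil => rfl
  | cons n l ih =>
    rw [word_cons]
    induction n with
    | zero => simp [numCount_cons, ih]
    | succ n ihn => simpa [List.replicate_succ, numCount_cons] using ihn

/-- The ones with exactly `i` zeros before them form the `i`-th block. A leading one lengthens block
`0`, and a leading zero shifts the numbering by one. -/
theorem numAt_word (l : List ℕ) (i : ℕ) : numAt (word l) i = l.getD i 0 := by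
  induction l generalizing i with
  | nil => rfl
  | cons n l ih =>
    rw [word_cons]
    induction n with
    | zero =>
      rcases i with _ | i
      · exact numAt_false_zero _
      · simpa [numAt_false_succ] using ih i
    | succ n ihn =>
      rw [List.replicate_succ, List.cons_append, numAt_true, ihn]
      rcases i with _ | i <;> simp

theorem closed_word (l : List ℕ) : Closed (word l) := by
  rcases List.eq_nil_or_concat l with rfl | ⟨l, n, rfl⟩
  · rfl
  · rw [List.concat_eq_append, word_append, word_cons, ← List.append_assoc]
    simp [Closed, bitAt, word]

/-- Reading from the front, a zero opens a new entry `0` and a one increments the first entry. Thus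
a trailing one is the only obstruction to being a code word. -/
theorem Closed.exists_word {u : List Bool} (h : Closed u) : ∃ l, u = word l := by
  induction u with
  | nil => exact ⟨[], rfl⟩
  | cons b u ih =>
    rcases u with _ | ⟨c, u⟩
    · rcases b with _ | _
      · exact ⟨[0], rfl⟩
      · exact absurd h (by simp [Closed, bitAt])
    · obtain ⟨l, hl⟩ := ih h
      rcases b with _ | _
      · exact ⟨0 :: l, by rw [hl]; rfl⟩
      · rcases l with _ | ⟨n, l⟩
        · simp [word] at hl
        · exact ⟨(n + 1) :: l, by rw [hl, word_cons, word_cons, List.replicate_succ]; rfl⟩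

theorem word_injective : Injective word := by
  intro l m h
  refine List.ext_getElem? fun i => ?_
  have h1 := numCount_word l
  rw [h, numCount_word] at h1
  have h2 := numAt_word l i
  rw [h, numAt_word] at h2
  rcases lt_or_ge i l.length with hi | hi
  · have hi' : i < m.length := h1 ▸ hi
    rw [List.getD_eq_getElem _ _ hi, List.getD_eq_getElem _ _ hi'] at h2
    rw [List.getElem?_eq_getElem hi, List.getElem?_eq_getElem hi', h2]
  · rw [List.getElem?_eq_none hi, List.getElem?_eq_none (h1 ▸ hi)]

theorem not_closed_singleton_true : ¬ Closed [true] := by simp [Closed, bitAt]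

/-! ### Unique readability of codes -/

/-- Unique readability is stated with arbitrary remainders `X` and `Y`, which makes it compose: each
piece is split off and the rest is the remainder. The types vary with the index because symbols have
different arities. -/
theorem flatten_ofFn_inj {n : ℕ} {α : Fin n → Type} (c : ∀ i, α i → List ℕ) (x y : ∀ i, α i)
    (h : ∀ i X Y, c i (x i) ++ X = c i (y i) ++ Y → x i = y i ∧ X = Y) {X Y : List ℕ}
    (e : (List.ofFn fun i => c i (x i)).flatten ++ X = (List.ofFn fun i => c i (y i)).flatten ++ Y) :
    x = y ∧ X = Y := by
  induction n with
  | zero => exact ⟨funext fun i => i.elim0, by simpa using e⟩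
  | succ n ih =>
    rw [List.ofFn_succ, List.ofFn_succ, List.flatten_cons, List.flatten_cons, List.append_assoc,
      List.append_assoc] at e
    obtain ⟨h0, e⟩ := h 0 _ _ e
    obtain ⟨h1, e⟩ := ih (fun i => c i.succ) (fun i => x i.succ) (fun i => y i.succ)
      (fun i => h i.succ) e
    exact ⟨funext (Fin.cases h0 (congrFun h1)), e⟩

theorem flatMap_finRange_inj {n : ℕ} {α : Fin n → Type} (c : ∀ i, α i → List ℕ) (x y : ∀ i, α i)
    (h : ∀ i X Y, c i (x i) ++ X = c i (y i) ++ Y → x i = y i ∧ X = Y) {X Y : List ℕ}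
    (e : (List.finRange n).flatMap (fun i => c i (x i)) ++ X =
      (List.finRange n).flatMap (fun i => c i (y i)) ++ Y) : x = y ∧ X = Y := by
  rw [List.flatMap_def, List.flatMap_def, ← List.ofFn_eq_map, ← List.ofFn_eq_map] at e
  exact flatten_ofFn_inj c x y h e

theorem flatMap_list_inj {α : Type} (c : α → List ℕ)
    (h : ∀ a b X Y, c a ++ X = c b ++ Y → a = b ∧ X = Y) :
    ∀ (l m : List α) (X Y : List ℕ), l.length = m.length → l.flatMap c ++ X = m.flatMap c ++ Y →
      l = m ∧ X = Y
  | [], [], _, _, _, e => ⟨rfl, by simpa using e⟩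
  | a :: l, b :: m, X, Y, hl, e => by
    rw [List.flatMap_cons, List.flatMap_cons, List.append_assoc, List.append_assoc] at e
    obtain ⟨rfl, e1⟩ := h _ _ _ _ e
    obtain ⟨rfl, e2⟩ := flatMap_list_inj c h l m X Y (by simpa using hl) e1
    exact ⟨rfl, e2⟩

theorem tupleCode_inj {a n : ℕ} {x y : Fin a → Fin n} {X Y : List ℕ}
    (e : tupleCode x ++ X = tupleCode y ++ Y) : x = y ∧ X = Y := by
  obtain ⟨h, e⟩ := List.append_inj e (by simp [tupleCode])
  exact ⟨funext fun i => Fin.ext (congrFun (List.ofFn_injective h) i), e⟩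

theorem tableCode_inj {n : ℕ} : ∀ (a : ℕ) (g g' : (Fin a → Fin n) → Fin n) (X Y : List ℕ),
    tableCode a g ++ X = tableCode a g' ++ Y → g = g' ∧ X = Y
  | 0, g, g', X, Y, e => by
    simp only [tableCode, List.cons_append, List.nil_append, List.cons.injEq] at e
    refine ⟨funext fun v => ?_, e.2⟩
    rw [Subsingleton.elim v Fin.elim0]
    exact Fin.ext e.1
  | a + 1, g, g', X, Y, e => by
    obtain ⟨h, e⟩ := flatMap_finRange_inj (fun _ => tableCode a)
      (fun i v => g (Fin.cons i v)) (fun i v => g' (Fin.cons i v))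
      (fun i X Y => tableCode_inj a _ _ X Y) e
    refine ⟨funext fun v => ?_, e⟩
    have := congrFun (congrFun h (v 0)) (Fin.tail v)
    rwa [Fin.cons_self_tail] at this

theorem Signature.code_inj {σ τ : Signature} {X Y : List ℕ} (e : σ.code ++ X = τ.code ++ Y) :
    σ = τ ∧ X = Y := by
  obtain ⟨r, f, hr⟩ := σ
  obtain ⟨r', f', hr'⟩ := τ
  simp only [Signature.code, List.cons_append, List.append_assoc, List.cons.injEq] at e
  obtain ⟨h, e⟩ := e
  obtain ⟨rfl, e1⟩ := List.append_inj e h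
  simp only [List.cons.injEq] at e1
  obtain ⟨h', e1⟩ := e1
  obtain ⟨rfl, e2⟩ := List.append_inj e1 h'
  exact ⟨rfl, e2⟩

theorem termCode_inj {σ : Signature} (s : σ.lang.Term ℕ) :
    ∀ (t : σ.lang.Term ℕ) (X Y : List ℕ), termCode s ++ X = termCode t ++ Y → s = t ∧ X = Y := by
  induction s with
  | var x =>
    rintro (y | @⟨n', f', ts'⟩) X Y e
    · simp only [termCode, List.cons_append, List.nil_append, List.cons.injEq, true_and] at e
      exact ⟨by rw [e.1], e.2⟩
    · simp [termCode] at e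
  | @func n f ts ih =>
    rintro (y | @⟨n', f', ts'⟩) X Y e
    · simp [termCode] at e
    · simp only [termCode, List.cons_append, List.cons.injEq, true_and] at e
      obtain ⟨hf, e⟩ := e
      -- Replacing the arity by the one listed in the signature makes the types of the argument
      -- tuples agree as soon as the symbols do.
      obtain ⟨i, rfl⟩ := f
      obtain ⟨j, rfl⟩ := f'
      obtain rfl : i = j := Fin.ext hf
      obtain ⟨rfl, e1⟩ := flatten_ofFn_inj (fun _ => termCode) ts ts' (fun k => ih k _) e
      exact ⟨rfl, e1⟩

theorem fmlCode_inj {σ : Signature} (F : Fml σ.lang) :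
    ∀ (G : Fml σ.lang) (X Y : List ℕ), fmlCode F ++ X = fmlCode G ++ Y → F = G ∧ X = Y := by
  induction F with
  | @rel n R ts =>
    rintro (@⟨n', R', ts'⟩ | _ | _ | _ | _ | _ | _) X Y e <;>
      simp only [fmlCode, List.cons_append, List.cons.injEq, true_and] at e <;>
      try exact absurd e.1 (by decide)
    obtain ⟨hf, e⟩ := e
    obtain ⟨i, rfl⟩ := R
    obtain ⟨j, rfl⟩ := R'
    obtain rfl : i = j := Fin.ext hf
    obtain ⟨rfl, e1⟩ := flatten_ofFn_inj (fun _ => termCode) ts ts' (fun k => termCode_inj _ _) e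
    exact ⟨rfl, e1⟩
  | eq s t =>
    rintro (@⟨n', R', ts'⟩ | _ | _ | _ | _ | _ | _) X Y e <;>
      simp only [fmlCode, List.cons_append, List.append_assoc, List.cons.injEq, true_and] at e <;>
      try exact absurd e.1 (by decide)
    obtain ⟨rfl, e1⟩ := termCode_inj _ _ _ _ e
    obtain ⟨rfl, e2⟩ := termCode_inj _ _ _ _ e1
    exact ⟨rfl, e2⟩
  | not F ih =>
    rintro (@⟨n', R', ts'⟩ | _ | _ | _ | _ | _ | _) X Y e <;>
      simp only [fmlCode, List.cons_append, List.append_assoc, List.cons.injEq, true_and] at e <;>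
      try exact absurd e.1 (by decide)
    obtain ⟨rfl, e1⟩ := ih _ _ _ e
    exact ⟨rfl, e1⟩
  | and F G ih ih' =>
    rintro (@⟨n', R', ts'⟩ | _ | _ | _ | _ | _ | _) X Y e <;>
      simp only [fmlCode, List.cons_append, List.append_assoc, List.cons.injEq, true_and] at e <;>
      try exact absurd e.1 (by decide)
    obtain ⟨rfl, e1⟩ := ih _ _ _ e
    obtain ⟨rfl, e2⟩ := ih' _ _ _ e1
    exact ⟨rfl, e2⟩
  | or F G ih ih' =>
    rintro (@⟨n', R', ts'⟩ | _ | _ | _ | _ | _ | _) X Y e <;>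
      simp only [fmlCode, List.cons_append, List.append_assoc, List.cons.injEq, true_and] at e <;>
      try exact absurd e.1 (by decide)
    obtain ⟨rfl, e1⟩ := ih _ _ _ e
    obtain ⟨rfl, e2⟩ := ih' _ _ _ e1
    exact ⟨rfl, e2⟩
  | ex x F ih =>
    rintro (@⟨n', R', ts'⟩ | _ | _ | _ | _ | _ | _) X Y e <;>
      simp only [fmlCode, List.cons_append, List.append_assoc, List.cons.injEq, true_and] at e <;>
      try exact absurd e.1 (by decide)
    obtain ⟨rfl, e1⟩ := e
    obtain ⟨rfl, e2⟩ := ih _ _ _ e1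
    exact ⟨rfl, e2⟩
  | all x F ih =>
    rintro (@⟨n', R', ts'⟩ | _ | _ | _ | _ | _ | _) X Y e <;>
      simp only [fmlCode, List.cons_append, List.append_assoc, List.cons.injEq, true_and] at e <;>
      try exact absurd e.1 (by decide)
    obtain ⟨rfl, e1⟩ := e
    obtain ⟨rfl, e2⟩ := ih _ _ _ e1
    exact ⟨rfl, e2⟩

theorem FinStr.code_inj {σ : Signature} {A B : FinStr σ} (e : A.code = B.code) : A = B := by
  obtain ⟨n, hn, r, f⟩ := A
  obtain ⟨n', hn', r', f'⟩ := B
  simp only [FinStr.code, List.cons.injEq] at e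
  obtain ⟨rfl, e1⟩ := e
  obtain ⟨rfl, e2⟩ := flatMap_finRange_inj
    (α := fun i => List (Fin (σ.rel.get i) → Fin n))
    (fun i l => l.length :: l.flatMap tupleCode) r r' (fun i X Y e => by
      simp only [List.cons_append, List.cons.injEq] at e
      exact flatMap_list_inj tupleCode (fun _ _ _ _ => tupleCode_inj) _ _ _ _ e.1 e.2) e1
  obtain ⟨rfl, -⟩ := flatMap_finRange_inj (X := []) (Y := [])
    (α := fun i => (Fin (σ.fn.get i) → Fin n) → Fin n)
    (fun i => tableCode (σ.fn.get i)) f f' (fun i => tableCode_inj _ _ _) (by simpa using e2)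
  rfl

/-- By unique readability, signature, sentence and structure are determined by the word, so no other
reading can make the instance positive. -/
theorem mem_pMC_iff {C : ∀ σ : Signature, Set (Fml σ.lang)} {σ : Signature} {F : Fml σ.lang}
    (hF : F ∈ C σ) (A : FinStr σ) :
    (word (σ.code ++ fmlCode F ++ A.code), F.size) ∈ (pMC C).lang ↔ Models A F := by
  refine ⟨?_, fun h => ⟨σ, F, A, hF, rfl, h⟩⟩
  rintro ⟨τ, G, B, _, e, h⟩
  have e := word_injective (congrArg Prod.fst e)
  rw [List.append_assoc, List.append_assoc] at e
  obtain ⟨rfl, e1⟩ := Signature.code_inj e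
  obtain ⟨rfl, e2⟩ := fmlCode_inj _ _ _ _ e1
  rwa [FinStr.code_inj e2]

theorem not_mem_pMC {C : ∀ σ : Signature, Set (Fml σ.lang)} {u : List Bool} (hu : ¬ Closed u)
    (k : ℕ) : (u, k) ∉ (pMC C).lang := by
  rintro ⟨τ, G, B, _, e, _⟩
  have e : u = _ := congrArg Prod.fst e
  rw [e] at hu
  exact hu (closed_word _)

/-! ### Blocks of quantifiers -/

section blocks

variable {L : FirstOrder.Language.{0, 0}}

/-- A whole block of quantifiers amounts to the choice of one assignment that is free on the block.
-/
theorem realize_foldr_ex {M : Type} [L.Structure M] (F : Fml L) (xs : List ℕ) :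
    ∀ v : ℕ → M, (xs.foldr Fml.ex F).Realize v ↔ ∃ w, (∀ j ∉ xs, w j = v j) ∧ F.Realize w := by
  induction xs with
  | nil =>
    refine fun v => ⟨fun h => ⟨v, fun _ _ => rfl, h⟩, ?_⟩
    rintro ⟨w, hw, h⟩
    rwa [funext fun j => hw j (List.not_mem_nil)] at h
  | cons x xs ih =>
    intro v
    simp only [List.foldr_cons, Fml.Realize, ih]
    constructor
    · rintro ⟨a, w, hw, h⟩
      refine ⟨w, fun j hj => ?_, h⟩
      rw [List.mem_cons, not_or] at hj
      rw [hw j hj.2, update_of_ne hj.1]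
    · rintro ⟨w, hw, h⟩
      refine ⟨w x, w, fun j hj => ?_, h⟩
      by_cases hjx : j = x
      · subst hjx
        simp
      · rw [update_of_ne hjx, hw j (by simp [hjx, hj])]

theorem free_foldr_ex (F : Fml L) (xs : List ℕ) :
    (xs.foldr Fml.ex F).free = F.free \ {x | x ∈ xs} := by
  induction xs with
  | nil => simp
  | cons x xs ih =>
    rw [List.foldr_cons, Fml.free, ih]
    ext y
    simp only [Set.mem_sdiff, Set.mem_ofPred_eq, Set.mem_singleton_iff, List.mem_cons]
    tauto

theorem size_foldr_ex (F : Fml L) (xs : List ℕ) : (xs.foldr Fml.ex F).size = F.size + xs.length := by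
  induction xs with
  | nil => rfl
  | cons x xs ih => rw [List.foldr_cons, Fml.size, ih, List.length_cons, add_assoc]

theorem fmlCode_foldr_ex {σ : Signature} (F : Fml σ.lang) (xs : List ℕ) :
    fmlCode (xs.foldr Fml.ex F) = xs.flatMap (fun x => [5, x]) ++ fmlCode F := by
  induction xs with
  | nil => rfl
  | cons x xs ih => rw [List.foldr_cons, fmlCode, ih]; rfl

end blocks

/-! ### Sentences about finite tables -/

/-- The signature of a binary function and two unary functions. -/
def tableSig : Signature := ⟨[], [2, 1, 1], by simp⟩

/-- The symbol for the binary function. -/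
def symD : tableSig.lang.Functions 2 := ⟨⟨0, by decide⟩, rfl⟩

/-- The symbol for the first unary function. -/
def symC : tableSig.lang.Functions 1 := ⟨⟨1, by decide⟩, rfl⟩

/-- The symbol for the second unary function. -/
def symA : tableSig.lang.Functions 1 := ⟨⟨2, by decide⟩, rfl⟩

/-- The term `d(x₁, d(x₂, … d(x_m, c(v₀))))` for a list of variables `x₁, …, x_m`. -/
def actTerm (l : List ℕ) : tableSig.lang.Term ℕ :=
  l.foldr (fun i t => .func symD ![.var i, t]) (.func symC ![.var 0])

/-- The variables `v₂, …, v_{k+1}`. -/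
def letterVars (k : ℕ) : List ℕ := (List.range k).map (· + 2)

/-- The sentence `∃ v₂ ⋯ ∃ v_{k+1} ∃ v₁ ∀ v₀, d(v₂, d(v₃, … d(v_{k+1}, c(v₀)))) = a(v_r)`. -/
def tableFml (r k : ℕ) : Fml tableSig.lang :=
  Fml.prenex true [letterVars k ++ [1], [0]] (.eq (actTerm (letterVars k)) (.func symA ![.var r]))

/-- The structure on `{0, …, N - 1}` given by a binary function and two unary functions. -/
def tableStr {N : ℕ} (hN : 0 < N) (d : Fin N → Fin N → Fin N) (c a : Fin N → Fin N) :
    FinStr tableSig where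
  card := N
  card_pos := hN
  rels i := i.elim0
  funs i := match i with
    | ⟨0, _⟩ => fun x => d (x ⟨0, Nat.zero_lt_two⟩) (x ⟨1, Nat.one_lt_two⟩)
    | ⟨1, _⟩ => fun x => c (x ⟨0, Nat.zero_lt_one⟩)
    | ⟨2, _⟩ => fun x => a (x ⟨0, Nat.zero_lt_one⟩)
    | ⟨_ + 3, h⟩ => absurd h (by simp [tableSig])

theorem tableFml_eq (r k : ℕ) : tableFml r k = (letterVars k ++ [1]).foldr Fml.ex
    (.all 0 (.eq (actTerm (letterVars k)) (.func symA ![.var r]))) := rfl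

theorem varFinset_actTerm (l : List ℕ) : (actTerm l).varFinset = insert 0 l.toFinset := by
  induction l with
  | nil =>
    ext x
    simp [actTerm, FirstOrder.Language.Term.varFinset]
  | cons i l ih =>
    have : actTerm (i :: l) = .func symD ![.var i, actTerm l] := rfl
    rw [this]
    ext x
    simp [FirstOrder.Language.Term.varFinset, Fin.exists_fin_two, ih]
    tauto

theorem termSize_actTerm (l : List ℕ) : termSize (actTerm l) = 2 * l.length + 2 := by
  induction l with
  | nil => simp [actTerm, termSize]
  | cons i l ih =>
    have : actTerm (i :: l) = .func symD ![.var i, actTerm l] := rfl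
    rw [this]
    simp [termSize, Fin.sum_univ_two, ih]
    omega

theorem termCode_actTerm (l : List ℕ) :
    termCode (actTerm l) = l.flatMap (fun i => [1, 0, 0, i]) ++ [1, 1, 0, 0] := by
  induction l with
  | nil => simp [actTerm, termCode, symC]
  | cons i l ih =>
    have : actTerm (i :: l) = .func symD ![.var i, actTerm l] := rfl
    rw [this]
    simp [termCode, symD, ih]

theorem length_letterVars (k : ℕ) : (letterVars k).length = k := by simp [letterVars]

theorem mem_letterVars {k x : ℕ} : x ∈ letterVars k ↔ 2 ≤ x ∧ x < k + 2 := by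
  simp only [letterVars, List.mem_map, List.mem_range]
  constructor
  · rintro ⟨i, hi, rfl⟩
    omega
  · intro h
    exact ⟨x - 2, by omega, by omega⟩

/-- The two terms have sizes `2k + 2` and `2`, the equation adds `1`, and there are `k + 2`
quantifiers. The total depends on `k` only, as required of the new parameter. -/
theorem size_tableFml (r k : ℕ) : (tableFml r k).size = 3 * k + 7 := by
  rw [tableFml_eq, size_foldr_ex]
  simp [Fml.size, termSize_actTerm, length_letterVars, termSize]
  omega

theorem tableFml_mem {r : ℕ} (hr : r ≤ 1) (k : ℕ) : tableFml r k ∈ SigmaFunc 2 1 tableSig := by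
  refine ⟨?_, _, _, rfl, ?_, ?_, rfl⟩
  · rw [Fml.IsSentence, tableFml_eq, free_foldr_ex]
    ext x
    simp [Fml.free, varFinset_actTerm, mem_letterVars, FirstOrder.Language.Term.varFinset]
    omega
  · simp
  · trivial

theorem fmlCode_tableFml (r k : ℕ) : fmlCode (tableFml r k) =
    (List.range k).flatMap (fun i => [5, i + 2]) ++ [5, 1, 6, 0, 1] ++
      ((List.range k).flatMap (fun i => [1, 0, 0, i + 2]) ++ [1, 1, 0, 0, 1, 2, 0, r]) := by
  rw [tableFml_eq, fmlCode_foldr_ex]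
  simp [fmlCode, termCode_actTerm, termCode, symA, letterVars, List.flatMap_map]

theorem flatMap_finRange_val (n : ℕ) (f : ℕ → List ℕ) :
    (List.finRange n).flatMap (fun i : Fin n => f i) = (List.range n).flatMap f := by
  rw [← List.map_coe_finRange_eq_range, List.flatMap_map]

section tableStr

variable {N : ℕ} (hN : 0 < N) {d : ℕ → ℕ → ℕ} {c a : ℕ → ℕ} (hd : ∀ i < N, ∀ j < N, d i j < N)
  (hc : ∀ i < N, c i < N) (ha : ∀ i < N, a i < N)

/-- The structure given by functions on the natural numbers. -/
def natTableStr : FinStr tableSig :=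
  tableStr hN (fun i j => ⟨d i j, hd i i.2 j j.2⟩) (fun i => ⟨c i, hc i i.2⟩)
    fun i => ⟨a i, ha i i.2⟩

theorem code_natTableStr : (natTableStr hN hd hc ha).code =
    N :: ((List.range N).flatMap (fun i => (List.range N).flatMap fun j => [d i j]) ++
      ((List.range N).flatMap (fun i => [c i]) ++ (List.range N).flatMap fun i => [a i])) := by
  have h : (natTableStr hN hd hc ha).code = N :: (
      (List.finRange N).flatMap (fun i : Fin N => (List.finRange N).flatMap fun j : Fin N => [d i j]) ++
      ((List.finRange N).flatMap (fun i : Fin N => [c i]) ++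
        ((List.finRange N).flatMap (fun i : Fin N => [a i]) ++ []))) := rfl
  rw [h, List.append_nil]
  have e : ∀ i : Fin N, (List.finRange N).flatMap (fun j : Fin N => [d i j]) =
      (List.range N).flatMap fun j => [d i j] := fun i => flatMap_finRange_val N fun j => [d i j]
  rw [funext e, flatMap_finRange_val N fun i => (List.range N).flatMap fun j => [d i j],
    flatMap_finRange_val N fun i => [c i], flatMap_finRange_val N fun i => [a i]]

theorem realize_actTerm (v : ℕ → Fin N) (l : List ℕ) :
    letI : tableSig.lang.Structure (Fin N) := (natTableStr hN hd hc ha).str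
    (((actTerm l).realize v : Fin N) : ℕ) = (l.map fun i => (v i : ℕ)).foldr d (c (v 0)) := by
  induction l with
  | nil => rfl
  | cons i l ih =>
    rw [List.map_cons, List.foldr_cons, ← ih]
    rfl

/-- The letter variables take the values listed in `w`, whose head is the outermost action and hence
is applied last; `z` is the value of `v₁`. -/
theorem models_natTableStr {r k : ℕ} (hr : r ≤ 1) :
    Models (natTableStr hN hd hc ha) (tableFml r k) ↔
      ∃ w : List ℕ, w.length = k ∧ (∀ x ∈ w, x < N) ∧
        ∃ z < N, ∀ y < N, w.foldr d (c y) = a (if r = 0 then y else z) := by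
  let : tableSig.lang.Structure (Fin N) := (natTableStr hN hd hc ha).str
  have hm : Models (natTableStr hN hd hc ha) (tableFml r k) ↔
      ∀ v : ℕ → Fin N, ∃ w : ℕ → Fin N, (∀ j ∉ letterVars k ++ [1], w j = v j) ∧
        ∀ y : Fin N, ((letterVars k).map fun i => (w i : ℕ)).foldr d (c y) =
          a (if r = 0 then y else w 1) := by
    refine forall_congr' fun v => ?_
    rw [tableFml_eq]
    refine (realize_foldr_ex (M := Fin N) _ _ v).trans (exists_congr fun w => and_congr_right
      fun _ => forall_congr' fun y => ?_)
    refine Fin.ext_iff.trans ?_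
    rw [realize_actTerm hN hd hc ha]
    -- The letter variables start at `2`, so the universal variable `v₀` does not affect them.
    have e1 : ((letterVars k).map fun i => ((update w 0 y i : Fin N) : ℕ)) =
        (letterVars k).map fun i => (w i : ℕ) := by
      refine List.map_congr_left fun i hi => ?_
      rw [update_of_ne]
      have := mem_letterVars.1 hi
      omega
    have e2 : (update w 0 y r : Fin N) = if r = 0 then y else w 1 := by
      rcases Nat.le_one_iff_eq_zero_or_eq_one.1 hr with rfl | rfl <;> simp
    rw [e1, update_self]
    change _ = a (update w 0 y r : Fin N) ↔ _
    rw [e2, apply_ite Fin.val]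
  rw [hm]
  constructor
  · intro h
    obtain ⟨w, -, hw⟩ := h fun _ => ⟨0, hN⟩
    refine ⟨(letterVars k).map fun i => (w i : ℕ), by simp [length_letterVars], ?_, w 1, (w 1).2,
      fun y hy => hw ⟨y, hy⟩⟩
    rintro x hx
    obtain ⟨i, -, rfl⟩ := List.mem_map.1 hx
    exact (w i).2
  · rintro ⟨w, rfl, hw, z, hz, h⟩ v
    -- The offset `2` undoes the shift in `letterVars`.
    refine ⟨fun j => if j = 1 then ⟨z, hz⟩ else if hj : 2 ≤ j ∧ j < w.length + 2 then
      ⟨w[j - 2]'(by omega), hw _ (List.getElem_mem _)⟩ else v j, fun j hj => ?_, fun y => ?_⟩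
    · rw [List.mem_append, mem_letterVars, not_or, List.mem_singleton] at hj
      dsimp only
      rw [if_neg hj.2, dif_neg hj.1]
    · dsimp only
      rw [if_pos rfl, ← h y y.2]
      congr 1
      refine List.ext_getElem (by simp [length_letterVars]) fun i h1 h2 => ?_
      simp [letterVars, h2]

end tableStr

/-- The computability hypotheses are stated for composed arguments, so that the table entries can be
generated inside nested loops. The bounds below `N u` are needed for valid words only: all others
are mapped to the word `[true]`, which encodes nothing. -/
theorem FptReducible.of_table {K : Set (List Bool × ℕ)} {r : ℕ} (hr : r ≤ 1)
    {V : List Bool → Prop} {N : List Bool → ℕ} {d : List Bool → ℕ → ℕ → ℕ}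
    {c a : List Bool → ℕ → ℕ} (cV : CmpPred 1 fun u _ => V u)
    (cN : ∀ m, Cmp m fun u _ => N u)
    (cd : ∀ m f g, Cmp m f → Cmp m g → Cmp m fun u ρ => d u (f u ρ) (g u ρ))
    (cc : ∀ m f, Cmp m f → Cmp m fun u ρ => c u (f u ρ))
    (ca : ∀ m f, Cmp m f → Cmp m fun u ρ => a u (f u ρ))
    (hN : ∀ u, V u → 0 < N u) (hd : ∀ u, V u → ∀ i < N u, ∀ j < N u, d u i j < N u)
    (hc : ∀ u, V u → ∀ i < N u, c u i < N u) (ha : ∀ u, V u → ∀ i < N u, a u i < N u)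
    (hK : ∀ u k, (u, k) ∈ K ↔ V u ∧ ∃ w : List ℕ, w.length = k ∧ (∀ x ∈ w, x < N u) ∧
      ∃ z < N u, ∀ y < N u, w.foldr (d u) (c u y) = a u (if r = 0 then y else z)) :
    FptReducible ⟨Bool, K⟩ (pMC (SigmaFunc 2 1)) := by
  classical
  let L : List Bool → ℕ → List ℕ := fun u k => tableSig.code ++ fmlCode (tableFml r k) ++
    N u :: ((List.range (N u)).flatMap (fun i => (List.range (N u)).flatMap fun j => [d u i j]) ++
      ((List.range (N u)).flatMap (fun i => [c u i]) ++
        (List.range (N u)).flatMap fun i => [a u i]))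
  have cL : ∀ m f, Cmp m f → GenList m fun u ρ => L u (f u ρ) := by
    intro m f hf
    have single : ∀ {m : ℕ} {f : List Bool → (Fin m → ℕ) → ℕ}, Cmp m f →
        GenList m fun u ρ => [f u ρ] := fun h => GenList.cons h GenList.nil
    have const : ∀ {m : ℕ} (l : List ℕ), GenList m fun _ _ => l := by
      intro m l
      induction l with
      | nil => exact GenList.nil
      | cons n l ih => exact GenList.cons (Cmp.const n) ih
    have last : ∀ {m : ℕ}, Cmp (m + 1) fun _ ρ => ρ (Fin.last m) := Cmp.var _
    refine GenList.append (GenList.append (const _) ?_) (GenList.cons (cN m) (GenList.append ?_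
      (GenList.append ?_ ?_)))
    · simp only [fmlCode_tableFml]
      refine GenList.append (GenList.append ?_ (const _)) (GenList.append ?_ (const _))
      · exact GenList.flatMap (L := fun _ _ i => [5, i + 2]) hf
          (GenList.cons (Cmp.const 5) (single (last.add (Cmp.const 2))))
      · exact GenList.flatMap (L := fun _ _ i => [1, 0, 0, i + 2]) hf
          (GenList.cons (Cmp.const 1) (GenList.cons (Cmp.const 0) (GenList.cons (Cmp.const 0)
            (single (last.add (Cmp.const 2))))))
    · refine GenList.flatMap (f := fun u _ => N u)
        (L := fun u _ i => (List.range (N u)).flatMap fun j => [d u i j]) (cN m) ?_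
      exact GenList.flatMap (f := fun u _ => N u) (L := fun u ρ j => [d u (ρ (Fin.last m)) j])
        (cN _) (single (cd _ _ _ last.weaken last))
    · exact GenList.flatMap (f := fun u _ => N u) (L := fun u ρ j => [c u j])
        (cN _) (single (cc _ _ last))
    · exact GenList.flatMap (f := fun u _ => N u) (L := fun u ρ j => [a u j])
        (cN _) (single (ca _ _ last))
  -- The copies of `none` are the new parameter in unary, as `tape` demands.
  refine FptReducible.of_gen (fun u k => if V u then word (L u k) else [true])
    (fun k => 3 * k + 7) ?_ (G := fun u ρ => List.replicate (3 * ρ 0 + 7) none ++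
      if V u then (word (L u (ρ 0))).map some else [some true]) ?_ ?_ ?_
  · exact (Primrec.nat_add.comp (Primrec.nat_mul.comp (Primrec.const 3) Primrec.id)
      (Primrec.const 7)).to_comp
  · exact Gen.append (Gen.replicate (((Cmp.const 3).mul (Cmp.var 0)).add (Cmp.const 7)) none)
      (Gen.ite cV (cL _ _ (Cmp.var 0).weaken) (Gen.singleton _))
  · intro u k
    by_cases hV : V u <;> simp [tape, hV]
  · intro u k
    rw [hK]
    by_cases hV : V u
    · have e : L u k = tableSig.code ++ fmlCode (tableFml r k) ++
          (natTableStr (hN u hV) (hd u hV) (hc u hV) (ha u hV)).code := by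
        rw [code_natTableStr]
      rw [if_pos hV, e, ← size_tableFml r k]
      exact (and_iff_right hV).trans ((models_natTableStr _ _ _ _ hr).symm.trans
        (mem_pMC_iff (C := SigmaFunc 2 1) (tableFml_mem hr k) _).symm)
    · rw [if_neg hV]
      exact iff_of_false (fun h => hV h.1) (not_mem_pMC not_closed_singleton_true _)

/-! ### Entries of tables written row by row. -/

theorem numAt_word_of_getElem? {l : List ℕ} {i x : ℕ} (h : l[i]? = some x) :
    numAt (word l) i = x := by
  rw [numAt_word, List.getD_eq_getElem?_getD, h, Option.getD_some]

theorem length_flatMap_const {α : Type} {f : α → List ℕ} {n : ℕ} {B : List α}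
    (hf : ∀ b ∈ B, (f b).length = n) : (B.flatMap f).length = B.length * n := by
  rw [List.length_flatMap, List.map_congr_left hf]
  simp

theorem getElem?_flatMap_const {α : Type} {f : α → List ℕ} {n : ℕ} (hf : ∀ b, (f b).length = n) :
    ∀ (B : List α) (x q : ℕ) (hx : x < B.length), q < n →
      (B.flatMap f)[x * n + q]? = (f B[x])[q]?
  | b :: B, 0, q, _, hq => by
    rw [List.flatMap_cons, List.getElem?_append_left (by simpa [hf] using hq)]
    simp
  | b :: B, x + 1, q, hx, hq => by
    have e : (x + 1) * n + q = (x * n + q) + n := by ring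
    rw [List.flatMap_cons, List.getElem?_append_right (by rw [hf]; omega), hf, e,
      Nat.add_sub_cancel, getElem?_flatMap_const hf B x q (by simpa using hx) hq]
    rfl

theorem mul_add_lt {x y n m : ℕ} (hx : x < m) (hy : y < n) : x * n + y < m * n :=
  calc x * n + y < x * n + n := Nat.add_lt_add_left hy _
    _ = (x + 1) * n := (Nat.succ_mul x n).symm
    _ ≤ m * n := Nat.mul_le_mul_right n hx

/-- Lists over `Fin m` are lists of numbers below `m`. -/
theorem exists_map_val {m : ℕ} {w : List ℕ} (hw : ∀ x ∈ w, x < m) :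
    ∃ w' : List (Fin m), w'.map Fin.val = w := by
  refine ⟨w.pmap (fun x hx => ⟨x, hx⟩) hw, ?_⟩
  rw [List.map_pmap]
  simp

/-! ### Factorization in transformation monoids -/

namespace Factor

/-- The sequence of numbers that encodes an instance. -/
def inst {n : ℕ} (a : Transf n) (B : List (Transf n)) : List ℕ :=
  n :: a.code ++ B.length :: B.flatMap Transf.code

section inst

variable {n : ℕ} (a : Transf n) (B : List (Transf n))

theorem length_code (f : Transf n) : f.code.length = n := by simp [Transf.code, tupleCode]

theorem length_inst : (inst a B).length = n + 2 + B.length * n := by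
  simp only [inst, List.length_append, List.length_cons, length_code,
    length_flatMap_const fun b _ => length_code b]
  omega

theorem inst_zero : (inst a B)[0]? = some n := rfl

theorem inst_target (i : Fin n) : (inst a B)[(i : ℕ) + 1]? = some (a.unop i : ℕ) := by
  rw [inst, List.getElem?_append_left (by simp [length_code]), List.getElem?_cons_succ]
  simp [Transf.code, tupleCode]

theorem inst_length : (inst a B)[n + 1]? = some B.length := by
  rw [inst, List.getElem?_append_right (by simp [length_code])]
  simp [length_code]

theorem inst_factor (x : Fin B.length) (q : Fin n) :
    (inst a B)[n + 2 + (x * n + q)]? = some ((B.get x).unop q : ℕ) := by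
  rw [inst, List.getElem?_append_right (by simp [length_code]; omega)]
  have e : n + 2 + (x * n + q) - (n :: a.code).length = (x * n + q) + 1 := by
    simp [length_code]
    omega
  rw [e, List.getElem?_cons_succ, getElem?_flatMap_const length_code B x q x.2 q.2]
  simp [Transf.code, tupleCode]

end inst

/-- The number of points. -/
def points (u : List Bool) : ℕ := numAt u 0

/-- The number of factors. -/
def factors (u : List Bool) : ℕ := numAt u (points u + 1)

/-- The word encodes an instance. -/
def Valid (u : List Bool) : Prop :=
  Closed u ∧ 1 ≤ points u ∧ numCount u = points u + 2 + factors u * points u ∧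
    (∀ i < points u, numAt u (i + 1) < points u) ∧
    ∀ i < factors u * points u, numAt u (points u + 2 + i) < points u

/-- The action of the factors. The number of points serves as a sink. -/
def act (u : List Bool) (x q : ℕ) : ℕ :=
  if x < factors u ∧ q < points u then numAt u (points u + 2 + (x * points u + q)) else points u

/-- A retraction to the points. -/
def clamp (u : List Bool) (y : ℕ) : ℕ := if y < points u then y else 0

/-- The transformation to be factorized. -/
def target (u : List Bool) (y : ℕ) : ℕ := numAt u (clamp u y + 1)

section

variable {n : ℕ} {a : Transf n} {B : List (Transf n)}

theorem points_inst : points (word (inst a B)) = n := numAt_word_of_getElem? (inst_zero a B)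

theorem factors_inst : factors (word (inst a B)) = B.length := by
  rw [factors, points_inst]
  exact numAt_word_of_getElem? (inst_length a B)

theorem act_inst (x : Fin B.length) (q : Fin n) :
    act (word (inst a B)) x q = ((B.get x).unop q : ℕ) := by
  rw [act, factors_inst, points_inst, if_pos ⟨x.2, q.2⟩]
  exact numAt_word_of_getElem? (inst_factor a B x q)

theorem valid_inst (hn : 1 ≤ n) : Valid (word (inst a B)) := by
  refine ⟨closed_word _, ?_, ?_, ?_, ?_⟩
  · rwa [points_inst]
  · rw [numCount_word, length_inst, points_inst, factors_inst]
  · intro i hi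
    rw [points_inst] at hi ⊢
    rw [numAt_word_of_getElem? (inst_target a B ⟨i, hi⟩)]
    exact Fin.is_lt _
  · intro i hi
    rw [points_inst, factors_inst] at hi
    rw [points_inst]
    have hx : i / n < B.length := Nat.div_lt_of_lt_mul (by rwa [mul_comm])
    have hq : i % n < n := Nat.mod_lt _ hn
    have h := numAt_word_of_getElem? (inst_factor a B ⟨i / n, hx⟩ ⟨i % n, hq⟩)
    dsimp only at h
    rw [Nat.div_add_mod'] at h
    rw [h]
    exact Fin.is_lt _

/-- The count of entries and their ranges are all that a code must satisfy. The maps are read off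
the word, and the two sequences are compared separately in the header, the target, the number of
factors and the table. -/
theorem Valid.exists_inst {u : List Bool} (h : Valid u) :
    ∃ (n : ℕ) (a : Transf n) (B : List (Transf n)), 1 ≤ n ∧ u = word (inst a B) := by
  obtain ⟨hc, hn, hlen, ha, hB⟩ := h
  set n := points u with hndef
  set m := factors u with hmdef
  let a : Transf n := MulOpposite.op fun i : Fin n => ⟨numAt u (i + 1), ha i i.2⟩
  let B : List (Transf n) := List.ofFn fun x : Fin m => MulOpposite.op fun q : Fin n =>
    ⟨numAt u (n + 2 + (x * n + q)), hB _ (mul_add_lt x.2 q.2)⟩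
  have hBl : B.length = m := List.length_ofFn
  refine ⟨n, a, B, hn, ?_⟩
  obtain ⟨l, rfl⟩ := hc.exists_word
  have hl : l.length = n + 2 + m * n := by rw [← numCount_word, hlen]
  congr 1
  refine List.ext_getElem (by rw [length_inst, hBl, hl]) fun i h1 h2 => ?_
  have hi : numAt (word l) i = l[i] := by
    rw [numAt_word, List.getD_eq_getElem _ _ h1]
  have key : ∀ x, (inst a B)[i]? = some x → x = numAt (word l) i → l[i] = (inst a B)[i] := by
    intro x hx hx'
    rw [List.getElem?_eq_getElem h2, Option.some.injEq] at hx
    rw [hx, hx', hi]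
  rcases i with _ | i
  · exact key n (inst_zero a B) rfl
  rcases lt_trichotomy i n with hin | rfl | hin
  · exact key _ (inst_target a B ⟨i, hin⟩) rfl
  · exact key _ (inst_length a B) hBl
  · obtain ⟨j, e⟩ : ∃ j, i + 1 = n + 2 + j := ⟨i - n - 1, by omega⟩
    have hj : j < m * n := by omega
    have hx : j / n < m := Nat.div_lt_of_lt_mul (by rwa [mul_comm])
    have hq : j % n < n := Nat.mod_lt _ hn
    have h := inst_factor a B ⟨j / n, by rwa [hBl]⟩ ⟨j % n, hq⟩
    dsimp only at h
    rw [Nat.div_add_mod', ← e] at h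
    refine key _ h ?_
    simp only [B, List.get_eq_getElem, List.getElem_ofFn]
    change numAt (word l) (n + 2 + (j / n * n + j % n)) = _
    rw [Nat.div_add_mod', ← e]

theorem foldr_act_inst (w : List (Fin B.length)) (q : Fin n) :
    (w.map Fin.val).foldr (act (word (inst a B))) q =
      (w.foldr (fun x q => (B.get x).unop q) q : Fin n) := by
  induction w with
  | nil => rfl
  | cons x w ih => rw [List.map_cons, List.foldr_cons, ih, act_inst]; rfl

/-- A false letter sends everything to the sink `points u`, and the sink is fixed by every action
because it is not a point. -/
theorem foldr_act_of_le {u : List Bool} (w : List ℕ) (q : ℕ) (hw : ∃ x ∈ w, factors u ≤ x) :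
    w.foldr (act u) q = points u := by
  induction w with
  | nil => simp at hw
  | cons x w ih =>
    rw [List.foldr_cons, act, if_neg]
    rintro ⟨h1, h2⟩
    obtain ⟨y, hy, hle⟩ := hw
    rcases List.mem_cons.1 hy with rfl | hy
    · omega
    · rw [ih ⟨y, hy, hle⟩] at h2
      omega

/-- Products are taken in the opposite monoid, so the last factor acts last; `pow_succ` splits it
off and it becomes the head of `w`. Thus `w` lists the factors in reverse order. -/
theorem mem_pow_iff (k : ℕ) (f : Transf n) : f ∈ {b | b ∈ B} ^ k ↔
    ∃ w : List (Fin B.length), w.length = k ∧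
      ∀ q, f.unop q = w.foldr (fun x q => (B.get x).unop q) q := by
  induction k generalizing f with
  | zero =>
    rw [pow_zero, Set.mem_one]
    constructor
    · rintro rfl
      exact ⟨[], rfl, fun q => rfl⟩
    · rintro ⟨w, hw, h⟩
      rw [List.length_eq_zero_iff.1 hw] at h
      exact MulOpposite.unop_injective (funext h)
  | succ k ih =>
    rw [pow_succ, Set.mem_mul]
    constructor
    · rintro ⟨g, hg, b, hb, rfl⟩
      obtain ⟨w, rfl, h⟩ := (ih g).1 hg
      obtain ⟨x, hx, rfl⟩ := List.getElem_of_mem (show b ∈ B from hb)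
      refine ⟨⟨x, hx⟩ :: w, rfl, fun q => ?_⟩
      rw [List.foldr_cons, ← h]
      rfl
    · rintro ⟨_ | ⟨x, w⟩, hw, h⟩
      · simp at hw
      · refine ⟨MulOpposite.op fun q => w.foldr (fun x q => (B.get x).unop q) q,
          (ih _).2 ⟨w, by simpa using hw, fun q => rfl⟩, B.get x, List.get_mem _ _, ?_⟩
        exact MulOpposite.unop_injective (funext fun q => (h q).symm)

theorem mem_pow_iff_table (hn : 1 ≤ n) (k : ℕ) : a ∈ {b | b ∈ B} ^ k ↔
    ∃ w : List ℕ, w.length = k ∧ (∀ x ∈ w, x < n + B.length + 1) ∧ ∃ z < n + B.length + 1,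
      ∀ y < n + B.length + 1, w.foldr (act (word (inst a B))) (clamp (word (inst a B)) y) =
        target (word (inst a B)) (if 0 = 0 then y else z) := by
  have hc : ∀ y, ∃ q : Fin n, clamp (word (inst a B)) y = q := by
    intro y
    rw [clamp, points_inst]
    split_ifs with h
    · exact ⟨⟨y, h⟩, rfl⟩
    · exact ⟨⟨0, hn⟩, rfl⟩
  have ht : ∀ y (q : Fin n), clamp (word (inst a B)) y = q →
      target (word (inst a B)) y = (a.unop q : ℕ) := by
    intro y q h
    rw [target, h]
    exact numAt_word_of_getElem? (inst_target a B q)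
  rw [mem_pow_iff]
  constructor
  · rintro ⟨w, hw, h⟩
    refine ⟨w.map Fin.val, by rw [List.length_map, hw], ?_, 0, by omega, fun y _ => ?_⟩
    · intro x hx
      obtain ⟨x, -, rfl⟩ := List.mem_map.1 hx
      have := x.2
      omega
    · obtain ⟨q, hq⟩ := hc y
      rw [if_pos rfl, ht y q hq, hq, foldr_act_inst, h]
  · rintro ⟨w, hw, -, z, -, h⟩
    -- With a false letter the left side would be the sink `n`, whereas values of `a` are below `n`.
    have hlt : ∀ x ∈ w, x < B.length := by
      by_contra! hx
      obtain ⟨q, hq⟩ := hc 0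
      have h0 := h 0 (by omega)
      rw [foldr_act_of_le _ _ (by rwa [factors_inst]), if_pos rfl, ht 0 q hq, points_inst] at h0
      exact (a.unop q).2.ne h0.symm
    obtain ⟨w, rfl⟩ := exists_map_val hlt
    refine ⟨w, by rwa [List.length_map] at hw, fun q => Fin.ext ?_⟩
    have hq : clamp (word (inst a B)) q = q := by
      rw [clamp, points_inst, if_pos q.2]
    rw [← foldr_act_inst, ← ht q q hq, ← hq, h q (by omega), if_pos rfl, hq]

end

theorem mem_pFT_iff (u : List Bool) (k : ℕ) : (u, k) ∈ pFT.lang ↔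
    Valid u ∧ ∃ w : List ℕ, w.length = k ∧ (∀ x ∈ w, x < points u + factors u + 1) ∧
      ∃ z < points u + factors u + 1, ∀ y < points u + factors u + 1,
        w.foldr (act u) (clamp u y) = target u (if 0 = 0 then y else z) := by
  constructor
  · rintro ⟨n, k, a, B, hn, e, h⟩
    obtain ⟨rfl, rfl⟩ := Prod.mk.inj e
    refine ⟨valid_inst hn, ?_⟩
    rw [mem_pow_iff_table hn] at h
    rw [← inst, points_inst, factors_inst]
    exact h
  · rintro ⟨hV, h⟩
    obtain ⟨n, a, B, hn, rfl⟩ := hV.exists_inst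
    refine ⟨n, k, a, B, hn, rfl, ?_⟩
    rw [points_inst, factors_inst] at h
    exact (mem_pow_iff_table hn k).2 h

section computation

variable {m : ℕ}

theorem cmp_points : Cmp m fun u _ => points u := Cmp.numAt (Cmp.const 0)

theorem cmp_factors : Cmp m fun u _ => factors u := Cmp.numAt (cmp_points.add (Cmp.const 1))

theorem cmp_clamp {f : List Bool → (Fin m → ℕ) → ℕ} (hf : Cmp m f) :
    Cmp m fun u ρ => clamp u (f u ρ) :=
  Cmp.ite (CmpPred.lt hf cmp_points) hf (Cmp.const 0)

theorem cmpPred_valid : CmpPred m fun u _ => Valid u := by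
  refine CmpPred.closed.and ((CmpPred.le (Cmp.const 1) cmp_points).and ((CmpPred.eq Cmp.numCount
    ((cmp_points.add (Cmp.const 2)).add (cmp_factors.mul cmp_points))).and
    (CmpPred.and ?_ ?_)))
  · exact CmpPred.forall_lt (p := fun u _ i => numAt u (i + 1) < points u) cmp_points
      (CmpPred.lt (Cmp.numAt ((Cmp.var (Fin.last m)).add (Cmp.const 1))) cmp_points)
  · exact CmpPred.forall_lt (f := fun u _ => factors u * points u)
      (p := fun u _ i => numAt u (points u + 2 + i) < points u) (cmp_factors.mul cmp_points)
      (CmpPred.lt (Cmp.numAt ((cmp_points.add (Cmp.const 2)).add (Cmp.var (Fin.last m)))) cmp_points)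

end computation

theorem pFT_mem_WFunc : pFT ∈ WFunc 2 := by
  refine FptReducible.of_table (K := pFT.lang) (r := 0) (Nat.zero_le 1) (V := Valid)
    -- This leaves room for the points, the indices of the factors and the sink.
    (N := fun u => points u + factors u + 1) (d := act) (c := clamp) (a := target)
    cmpPred_valid (fun m => (cmp_points.add cmp_factors).add (Cmp.const 1)) ?_
    (fun m f hf => cmp_clamp hf) (fun m f hf => Cmp.numAt ((cmp_clamp hf).add (Cmp.const 1)))
    (fun u _ => Nat.succ_pos _) ?_ ?_ ?_ mem_pFT_iff
  · intro m f g hf hg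
    exact Cmp.ite ((CmpPred.lt hf cmp_factors).and (CmpPred.lt hg cmp_points))
      (Cmp.numAt ((cmp_points.add (Cmp.const 2)).add ((hf.mul cmp_points).add hg))) cmp_points
  · rintro u ⟨_, _, _, _, h⟩ i _ j _
    rw [act]
    split_ifs with hij
    · have := h _ (mul_add_lt hij.1 hij.2)
      omega
    · omega
  · intro u _ i _
    rw [clamp]
    split_ifs <;> omega
  · rintro u ⟨_, hn, _, h, _⟩ i _
    have hc : clamp u i < points u := by
      rw [clamp]
      split_ifs <;> omega
    have := h _ hc
    rw [target]
    omega

end Factor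

/-! ### Synchronizing words -/

namespace Sync

section code

variable {s n : ℕ} (A : DFA (Fin s) (Fin n))

theorem length_row (q : Fin n) :
    ((List.finRange s).map fun c => (A.step q c : ℕ)).length = s := by simp

theorem length_dfaCode : (dfaCode A).length = 3 + n + n * s := by
  simp only [dfaCode, List.length_cons, List.length_append, List.length_map, List.length_finRange,
    length_flatMap_const fun q _ => length_row A q]
  omega

theorem dfaCode_states : (dfaCode A)[0]? = some n := rfl

theorem dfaCode_letters : (dfaCode A)[1]? = some s := rfl

theorem dfaCode_start : (dfaCode A)[2]? = some (A.start : ℕ) := rfl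

open Classical in
theorem dfaCode_accept (q : Fin n) :
    (dfaCode A)[3 + (q : ℕ)]? = some (if q ∈ A.accept then 1 else 0) := by
  rw [dfaCode, add_comm, List.getElem?_cons_succ, List.getElem?_cons_succ, List.getElem?_cons_succ,
    List.getElem?_append_left (by simp)]
  simp

theorem dfaCode_step (q : Fin n) (c : Fin s) :
    (dfaCode A)[3 + n + (q * s + c : ℕ)]? = some (A.step q c : ℕ) := by
  have e : 3 + n + (q * s + c : ℕ) = n + (q * s + c) + 3 := by ring
  rw [dfaCode, e, List.getElem?_cons_succ, List.getElem?_cons_succ, List.getElem?_cons_succ,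
    List.getElem?_append_right (by simp)]
  simp only [List.length_map, List.length_finRange, Nat.add_sub_cancel_left]
  rw [getElem?_flatMap_const (length_row A) _ _ _ (by simp) c.2]
  simp

end code

/-- The number of states. -/
def states (u : List Bool) : ℕ := numAt u 0

/-- The number of letters. -/
def letters (u : List Bool) : ℕ := numAt u 1

/-- The word encodes a finite automaton. -/
def Valid (u : List Bool) : Prop :=
  Closed u ∧ numAt u 2 < states u ∧ numCount u = 3 + states u + states u * letters u ∧
    (∀ i < states u, numAt u (3 + i) < 2) ∧
    ∀ i < states u * letters u, numAt u (3 + states u + i) < states u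

/-- The action of the letters. Numbers that are not letters act as the identity. -/
def act (u : List Bool) (x q : ℕ) : ℕ :=
  if x < letters u ∧ q < states u then numAt u (3 + states u + (q * letters u + x)) else q

/-- A retraction to the states. -/
def clamp (u : List Bool) (y : ℕ) : ℕ := if y < states u then y else 0

section

variable {s n : ℕ} {A : DFA (Fin s) (Fin n)}

theorem states_dfaCode : states (word (dfaCode A)) = n := numAt_word_of_getElem? (dfaCode_states A)

theorem letters_dfaCode : letters (word (dfaCode A)) = s :=
  numAt_word_of_getElem? (dfaCode_letters A)

theorem act_dfaCode (x : Fin s) (q : Fin n) :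
    act (word (dfaCode A)) x q = (A.step q x : ℕ) := by
  rw [act, letters_dfaCode, states_dfaCode, if_pos ⟨x.2, q.2⟩]
  exact numAt_word_of_getElem? (dfaCode_step A q x)

theorem valid_dfaCode : Valid (word (dfaCode A)) := by
  refine ⟨closed_word _, ?_, ?_, ?_, ?_⟩
  · rw [states_dfaCode, numAt_word_of_getElem? (dfaCode_start A)]
    exact A.start.2
  · rw [numCount_word, length_dfaCode, states_dfaCode, letters_dfaCode]
  · intro i hi
    rw [states_dfaCode] at hi
    have h := numAt_word_of_getElem? (dfaCode_accept A ⟨i, hi⟩)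
    dsimp only at h
    rw [h]
    split_ifs <;> omega
  · intro i hi
    rw [states_dfaCode, letters_dfaCode] at hi
    rw [states_dfaCode]
    -- An automaton may have no letters, but then its transition table has no entries.
    have hs : 0 < s := Nat.pos_of_ne_zero (by rintro rfl; simp at hi)
    have hx : i / s < n := Nat.div_lt_of_lt_mul (by rwa [mul_comm])
    have hq : i % s < s := Nat.mod_lt _ hs
    have h := numAt_word_of_getElem? (dfaCode_step A ⟨i / s, hx⟩ ⟨i % s, hq⟩)
    dsimp only at h
    rw [Nat.div_add_mod'] at h
    rw [h]
    exact Fin.is_lt _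

theorem Valid.exists_dfa {u : List Bool} (h : Valid u) :
    ∃ (s n : ℕ) (A : DFA (Fin s) (Fin n)), u = word (dfaCode A) := by
  obtain ⟨hc, h0, hlen, hacc, hstep⟩ := h
  set n := states u with hndef
  set s := letters u with hsdef
  let A : DFA (Fin s) (Fin n) :=
    { step := fun q c => ⟨numAt u (3 + n + (q * s + c)), hstep _ (mul_add_lt q.2 c.2)⟩
      start := ⟨numAt u 2, h0⟩
      accept := {q | numAt u (3 + q) = 1} }
  refine ⟨s, n, A, ?_⟩
  obtain ⟨l, rfl⟩ := hc.exists_word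
  have hl : l.length = 3 + n + n * s := by rw [← numCount_word, hlen]
  congr 1
  refine List.ext_getElem (by rw [length_dfaCode, hl]) fun i h1 h2 => ?_
  have hi : numAt (word l) i = l[i] := by
    rw [numAt_word, List.getD_eq_getElem _ _ h1]
  have key : ∀ x, (dfaCode A)[i]? = some x → x = numAt (word l) i → l[i] = (dfaCode A)[i] := by
    intro x hx hx'
    rw [List.getElem?_eq_getElem h2, Option.some.injEq] at hx
    rw [hx, hx', hi]
  rcases i with _ | _ | _ | i
  · exact key n (dfaCode_states A) rfl
  · exact key s (dfaCode_letters A) rfl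
  · exact key _ (dfaCode_start A) rfl
  have e : i + 1 + 1 + 1 = 3 + i := by ring
  rcases lt_or_ge i n with hin | hin
  · classical
    have h := dfaCode_accept A ⟨i, hin⟩
    dsimp only at h
    rw [← e] at h
    refine key _ h ?_
    -- An entry below `2` is `0` or `1`, so it is determined by whether it equals `1`.
    have h2 := hacc i hin
    rw [← e] at h2
    have hA : (⟨i, hin⟩ : Fin n) ∈ A.accept ↔ numAt (word l) (i + 1 + 1 + 1) = 1 := by
      rw [e]
      rfl
    split_ifs with ha
    · exact (hA.1 ha).symm
    · have := mt hA.2 ha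
      omega
  · obtain ⟨j, rfl⟩ : ∃ j, i = n + j := ⟨i - n, by omega⟩
    have hj : j < n * s := by omega
    have hs : 0 < s := Nat.pos_of_ne_zero fun hs => by rw [hs] at hj; simp at hj
    have hx : j / s < n := Nat.div_lt_of_lt_mul (by rwa [mul_comm])
    have hq : j % s < s := Nat.mod_lt _ hs
    have h := dfaCode_step A ⟨j / s, hx⟩ ⟨j % s, hq⟩
    dsimp only at h
    rw [Nat.div_add_mod', add_assoc, ← e] at h
    refine key _ h ?_
    change numAt (word l) (3 + n + (j / s * s + j % s)) = _
    rw [Nat.div_add_mod', add_assoc, ← e]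

/-- The automaton reads its word from the left, whereas the nested term applies the last letter
first; hence the reversal. -/
theorem foldr_act_dfaCode (w : List (Fin s)) (q : Fin n) :
    (w.map Fin.val).foldr (act (word (dfaCode A))) q = (A.evalFrom q w.reverse : ℕ) := by
  rw [DFA.evalFrom, List.foldl_reverse]
  induction w with
  | nil => rfl
  | cons x w ih => rw [List.map_cons, List.foldr_cons, ih, act_dfaCode]; rfl

theorem foldr_act_filter {u : List Bool} (w : List ℕ) (q : ℕ) :
    (w.filter (· < letters u)).foldr (act u) q = w.foldr (act u) q := by
  induction w with
  | nil => rfl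
  | cons x w ih =>
    by_cases hx : x < letters u
    · rw [List.filter_cons_of_pos (by simpa using hx), List.foldr_cons, List.foldr_cons, ih]
    · rw [List.filter_cons_of_neg (by simpa using hx), List.foldr_cons, ih, act,
        if_neg fun h => hx h.1]

/-- False letters act as the identity, so inserting them pads a shorter word to length exactly `k`,
and deleting them gives back a word of length at most `k`. -/
theorem exists_synchronizing_iff (k : ℕ) :
    (∃ w : List (Fin s), w.length ≤ k ∧ IsSynchronizing A w) ↔
      ∃ w : List ℕ, w.length = k ∧ (∀ x ∈ w, x < n + s) ∧ ∃ z < n + s, ∀ y < n + s,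
        w.foldr (act (word (dfaCode A))) (clamp (word (dfaCode A)) y) = if 1 = 0 then y else z := by
  have hn : 0 < n := A.start.pos
  have hc : ∀ y, ∃ q : Fin n, clamp (word (dfaCode A)) y = q := by
    intro y
    rw [clamp, states_dfaCode]
    split_ifs with h
    · exact ⟨⟨y, h⟩, rfl⟩
    · exact ⟨⟨0, hn⟩, rfl⟩
  constructor
  · rintro ⟨w, hw, z, hz⟩
    -- The padding symbol `s` is not a letter, and it lies below `n + s` because the start state
    -- makes `n` positive.
    refine ⟨List.replicate (k - w.length) s ++ w.reverse.map Fin.val, by simp; omega, ?_,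
      z, by omega, fun y _ => ?_⟩
    · intro x hx
      rcases List.mem_append.1 hx with hx | hx
      · have := List.eq_of_mem_replicate hx
        omega
      · obtain ⟨x, -, rfl⟩ := List.mem_map.1 hx
        omega
    · obtain ⟨q, hq⟩ := hc y
      have h0 : (List.replicate (k - w.length) s).filter
          (· < letters (word (dfaCode A))) = [] := by
        rw [letters_dfaCode]
        simp
      rw [List.foldr_append, ← foldr_act_filter (List.replicate _ _), h0, hq, foldr_act_dfaCode,
        List.reverse_reverse, hz]
      rfl
  · rintro ⟨w, rfl, -, z, -, h⟩
    -- The genuine letters form a word with the same action.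
    obtain ⟨w', hw'⟩ := exists_map_val (m := s) (w := w.filter (· < letters (word (dfaCode A))))
      fun x hx => by simpa [letters_dfaCode] using (List.mem_filter.1 hx).2
    have hz : ∀ p : Fin n, (A.evalFrom p w'.reverse : ℕ) = z := by
      intro p
      have hp := h p (by omega)
      have e : clamp (word (dfaCode A)) p = p := by
        rw [clamp, states_dfaCode, if_pos p.2]
      rw [e, ← foldr_act_filter, ← hw', foldr_act_dfaCode] at hp
      simpa using hp
    refine ⟨w'.reverse, ?_, A.evalFrom ⟨0, hn⟩ w'.reverse, fun p =>
      Fin.ext ((hz p).trans (hz _).symm)⟩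
    rw [List.length_reverse, ← List.length_map (f := Fin.val), hw']
    exact List.length_filter_le _ _

end

theorem mem_pDFASW_iff (u : List Bool) (k : ℕ) : (u, k) ∈ pDFASW.lang ↔
    Valid u ∧ ∃ w : List ℕ, w.length = k ∧ (∀ x ∈ w, x < states u + letters u) ∧
      ∃ z < states u + letters u, ∀ y < states u + letters u,
        w.foldr (act u) (clamp u y) = if 1 = 0 then y else z := by
  constructor
  · rintro ⟨s, n, k, A, e, h⟩
    obtain ⟨rfl, rfl⟩ := Prod.mk.inj e
    refine ⟨valid_dfaCode, ?_⟩
    rw [states_dfaCode, letters_dfaCode]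
    exact (exists_synchronizing_iff k).1 h
  · rintro ⟨hV, h⟩
    obtain ⟨s, n, A, rfl⟩ := hV.exists_dfa
    refine ⟨s, n, k, A, rfl, ?_⟩
    rw [states_dfaCode, letters_dfaCode] at h
    exact (exists_synchronizing_iff k).2 h

section computation

variable {m : ℕ}

theorem cmp_states : Cmp m fun u _ => states u := Cmp.numAt (Cmp.const 0)

theorem cmp_letters : Cmp m fun u _ => letters u := Cmp.numAt (Cmp.const 1)

theorem cmpPred_valid : CmpPred m fun u _ => Valid u := by
  refine CmpPred.closed.and ((CmpPred.lt (Cmp.numAt (Cmp.const 2)) cmp_states).and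
    ((CmpPred.eq Cmp.numCount (((Cmp.const 3).add cmp_states).add
      (cmp_states.mul cmp_letters))).and (CmpPred.and ?_ ?_)))
  · exact CmpPred.forall_lt (p := fun u _ i => numAt u (3 + i) < 2) cmp_states
      (CmpPred.lt (Cmp.numAt ((Cmp.const 3).add (Cmp.var (Fin.last m)))) (Cmp.const 2))
  · exact CmpPred.forall_lt (f := fun u _ => states u * letters u)
      (p := fun u _ i => numAt u (3 + states u + i) < states u) (cmp_states.mul cmp_letters)
      (CmpPred.lt (Cmp.numAt (((Cmp.const 3).add cmp_states).add (Cmp.var (Fin.last m)))) cmp_states)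

end computation

theorem pDFASW_mem_WFunc : pDFASW ∈ WFunc 2 := by
  refine FptReducible.of_table (K := pDFASW.lang) (r := 1) le_rfl (V := Valid)
    -- No sink is needed here; a valid word has a start state, so at least one element, `letters u`,
    -- is available as padding.
    (N := fun u => states u + letters u) (d := act) (c := clamp) (a := fun _ y => y)
    cmpPred_valid (fun m => cmp_states.add cmp_letters) ?_ ?_ (fun m f hf => hf) ?_ ?_ ?_
    (fun _ _ _ hi => hi) mem_pDFASW_iff
  · intro m f g hf hg
    exact Cmp.ite ((CmpPred.lt hf cmp_letters).and (CmpPred.lt hg cmp_states))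
      (Cmp.numAt (((Cmp.const 3).add cmp_states).add ((hg.mul cmp_letters).add hf))) hg
  · intro m f hf
    exact Cmp.ite (CmpPred.lt hf cmp_states) hf (Cmp.const 0)
  · rintro u ⟨_, h, _⟩
    omega
  · rintro u ⟨_, _, _, _, h⟩ i _ j hj
    rw [act]
    split_ifs with hij
    · have := h _ (mul_add_lt hij.2 hij.1)
      omega
    · exact hj
  · intro u _ i _
    rw [clamp]
    split_ifs <;> omega

end Sync

end PFact

theorem theorem4p2 :
    PFact.pFT ∈ PFact.WFunc 2 ∧ PFact.WSync ⊆ PFact.WFunc 2 :=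
  ⟨PFact.Factor.pFT_mem_WFunc, fun _ hK => PFact.FptReducible.trans hK PFact.Sync.pDFASW_mem_WFunc⟩
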